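/- For $p\in[1,\infty)$ let $|\gamma|_{V^p}=\sup_{x_0<\dots<x_N}\bigl(\sum_{i=1}^N|\gamma(x_i)-\gamma(x_{i-1})|^p\bigr)^{1/p}$ denote the $p$-variation of a function $\gamma\colon\mathbb R\to\mathbb R$. For a bounded interval $A$ the Riemann--Stieltjes integral $\int_A\gamma\,d\beta$ is the limit (when it exists) of the sums $\sum_{k=1}^N\gamma(y_k)(\beta(x_k)-\beta(x_{k-1}))$ over $x_0<\dots<x_N$ and $y_1<\dots<y_N$ in $A$ with $x_{k-1}\le y_k\le x_k$, as $\max\{x_0-\inf A,\,x_1-x_0,\dots,x_N-x_{N-1},\,\sup A-x_N\}\to0$; and $\int_{\mathbb R}\gamma\,d\beta=\lim_{R\to\infty}\int_{(-R,R)}\gamma\,d\beta$. An \emph{Osgood modulus} is a continuous function $\omega\colon[0,\infty)\to[0,\infty)$ with $\omega(h)>0$ for $h>0$ and $\int_0^\epsilon dh/\omega(h)=\infty$ for every $\epsilon>0$. \textbf{Theorem.} For every $p\in[1,\infty)$ there is a constant $K_p\ge0$, depending only on $p$, with the following property. Let $\omega\colon[0,\infty)\to[0,\infty)$ be concave with $\sup_{0<h<1}\omega(h)/h^{\alpha}<\infty$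 for all $\alpha\in(0,1)$, let $C$ be any constant with $\omega(h)\le C h^{1-\frac1{2p}}$ for $0<h<1$, and put \[ c:=K_pC,\qquad \omega^*(h):=h^{2-2p}\,\omega\bigl(h^{2p-1}\bigr)+c\,h\quad(h>0),\qquad \omega^*(0):=0 . \] Then: \begin{enumerate} \item Let $L>0$, let $\gamma\colon\mathbb R\to[0,\infty)$ satisfy $|\gamma|_{V^p}<\infty$ and vanish outside an interval of length $L$, and let $\beta\colon\mathbb R\to\mathbb R$ be continuous with $\beta(x)-\beta(y)\le\omega(x-y)$ for all $x>y$. Then $\gamma$ is integrable, the Riemann--Stieltjes integral $\int_{\mathbb R}\gamma\,d\beta$ exists, and \[ \int_{\mathbb R}\gamma\,d\beta\;\le\;|\gamma|_{V^p}\,L^{1-\frac1p}\;\omega^*\!\left(\frac{\|\gamma\|_{L^1}}{|\gamma|_{V^p}\,L^{1-\frac1p}}\right), \] where the right-hand side is read as $0$ if $|\gamma|_{V^p}=0$. \item If $\omega$ is an Osgood modulus, then so is $\omega^*$. \end{enumerate} -/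

import Mathlib

open Set Filter Topology MeasureTheory
open scoped ENNReal

noncomputable section

/-- A partition of `A ⊆ ℝ`: a strictly increasing finite tuple of points of `A`. -/
def IsTuplePartition (A : Set ℝ) {n : ℕ} (x : Fin n → ℝ) : Prop :=
  StrictMono x ∧ ∀ i, x i ∈ A

/-- The resolution
`max {x₀ - inf A, x₁ - x₀, …, x_N - x_{N-1}, sup A - x_N}`
of a partition `x₀ < … < x_N` of a bounded interval `A`. -/
def partitionResolution (A : Set ℝ) {N : ℕ} (x : Fin (N + 1) → ℝ) : ℝ :=
  max (x 0 - sInf A)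
    (max (⨆ i : Fin N, (x i.succ - x i.castSucc)) (sSup A - x (Fin.last N)))

/-- The `p`-variation (for `0 < p < ∞`) of `f` on `A`, as an extended nonnegative real:
the supremum of `(∑ |f (x_i) - f (x_{i-1})| ^ p) ^ (1 / p)` over all partitions of `A`. -/
def ePVariationOn (p : ℝ) (f : ℝ → ℝ) (A : Set ℝ) : ℝ≥0∞ :=
  ⨆ (N : ℕ) (x : Fin (N + 1) → ℝ) (_ : IsTuplePartition A x),
    ENNReal.ofReal ((∑ i : Fin N, |f (x i.succ) - f (x i.castSucc)| ^ p) ^ (1 / p))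

/-- The `p`-variation as a real number (meaningful when `ePVariationOn p f A ≠ ∞`). -/
def pVariationOn (p : ℝ) (f : ℝ → ℝ) (A : Set ℝ) : ℝ :=
  (ePVariationOn p f A).toReal

/-- The Riemann–Stieltjes sum of `f` against `g` with division points `x` and tags `y`. -/
def rsSum (f g : ℝ → ℝ) {N : ℕ} (x : Fin (N + 1) → ℝ) (y : Fin N → ℝ) : ℝ :=
  ∑ i : Fin N, f (y i) * (g (x i.succ) - g (x i.castSucc))

/-- `I` is the Riemann–Stieltjes integral of `f` against `g` over the bounded interval `A`:
the limit of the Riemann–Stieltjes sums as the resolution of the partition `x` of `A` tends to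
zero, the tags `y` being a partition of `A` that interlaces `x`. -/
def HasRSIntegralOn (f g : ℝ → ℝ) (A : Set ℝ) (I : ℝ) : Prop :=
  ∀ ε > 0, ∃ δ > 0, ∀ (N : ℕ) (x : Fin (N + 1) → ℝ) (y : Fin N → ℝ),
    IsTuplePartition A x → IsTuplePartition A y →
    (∀ i : Fin N, y i ∈ Icc (x i.castSucc) (x i.succ)) →
    partitionResolution A x < δ → |rsSum f g x y - I| < ε

/-- `I` is the Riemann–Stieltjes integral of `f` against `g` over `ℝ`: the integrals over all
intervals `(-R, R)` exist, and converge to `I` as `R → ∞`. -/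
def HasRSIntegral (f g : ℝ → ℝ) (I : ℝ) : Prop :=
  ∃ J : ℝ → ℝ, (∀ R > 0, HasRSIntegralOn f g (Ioo (-R) R) (J R)) ∧ Tendsto J atTop (𝓝 I)

/-- Osgood moduli `ω : [0, ∞) → [0, ∞)` (values of `ω` at negative numbers are irrelevant). -/
structure IsOsgoodModulus (ω : ℝ → ℝ) : Prop where
  continuousOn : ContinuousOn ω (Ici 0)
  nonneg : ∀ h ≥ 0, 0 ≤ ω h
  pos : ∀ h > 0, 0 < ω h
  lintegral_eq_top : ∀ ε > 0, ∫⁻ h in Ioo 0 ε, ENNReal.ofReal (1 / ω h) = ∞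

/-- `β` has the one-sided modulus of continuity `ω`. -/
def HasOneSidedModulus (β ω : ℝ → ℝ) : Prop :=
  ∀ x y : ℝ, y < x → β x - β y ≤ ω (x - y)

/-- Hölder condition of all orders less than one on a modulus:
`sup_{0 < h < 1} ω h / h ^ α < ∞` for all `α ∈ (0, 1)`. -/
def IsHolderAllOrdersLTOne (ω : ℝ → ℝ) : Prop :=
  ∀ α ∈ Ioo (0 : ℝ) 1, BddAbove ((fun h => ω h / h ^ α) '' Ioo 0 1)

/-- The modulus `ω*(h) = h ^ (2 - 2p) * ω (h ^ (2p - 1)) + c * h`. If `ω 0 = 0`, its value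
at `h = 0` is `0`, also for `p > 1`, where Lean's `0 ^ (2 - 2p)` is `0`. -/
def starModulus (ω : ℝ → ℝ) (p c h : ℝ) : ℝ :=
  h ^ (2 - 2 * p) * ω (h ^ (2 * p - 1)) + c * h

end

/-!
The starting point is that upper bounds for the increments of `β` give upper bounds for
`∑ a i * (β (x (i + 1)) - β (x i))` as long as the values `a i` are nonnegative, and that this
survives coarsening. When two adjacent cells are merged and keep the smaller of their values, the
sum drops by at most the jump between the two values times `ω` of the length of the merged pair
(`exists_merge`). Among `m` adjacent pairs, one has both a jump of at most `V * (2 / m) ^ (1 / p)`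
and a length of at most `4 * L / m`, since the sum of the `p`-th powers of the jumps is at most
`V ^ p` and the lengths add up to at most `2 * L`. Coarsening any partition to `n` cells therefore
costs at most a tail of a series that converges because `ω h ≤ C * h ^ (1 - 1 / (2 * p))`
(`exists_coarsening`, `sum_coarsening_loss_le`), uniformly in the partition.

The coarse values start and end at zero, so by Hölder's inequality their total increase is at most
`P = V * (L / ℓ) ^ (1 - 1 / p)`, where `L / ℓ` is roughly the number of coarse cells. Replacing `ω`
by an affine majorant touching it at `S / P`, with `S` the `L¹` norm, and summing by parts bounds
the coarse sum by `P * ω (S / P)`, with constant one (`cellSum_le_mul_sum_posPart`,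
`cellSum_le_of_coarsening`). With `h` the argument of `ω*` in the theorem, the choice
`ℓ = h ^ (2 * p)` turns this into the first term of `ω*` and the cost of coarsening into a multiple
of `C * h` (`cellSum_le_starModulus`).

The same estimate gives existence of the integral. A function of bounded `p`-variation is uniformly
close to step functions `γ ∘ τ` with `τ` monotone (`HasPVariationLE.exists_step_approx`), hence
close in `2p`-variation. All Riemann–Stieltjes sums of a function `f` on `(-R, R)` are controlled by
its `2p`-variation and its supremum `η`: apply the upper bound to the nonnegative functions `η + f`
and `η - f` (`exists_abs_rsSum_le`). As step functions are integrable against the continuous `β`, so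
is `γ` (`exists_hasRSIntegralOn`). The integral is then the limit of sums over uniform grids of the
interval supporting `γ`, with tags at which `γ` is at most its average over the cell, which keeps
the `L¹` norm of the step functions below that of `γ` (`HasRSIntegralOn.le_starModulus`).

For the Osgood condition, the substitution `t = h ^ (2 * p - 1)` turns `dh / ω*(h)` into a multiple
of `dt / (ω t + c * t)`, and `c * t` is dominated by `ω t` since `ω` is concave
(`IsOsgoodModulus.starModulus`).
-/

/-! ### Functions of bounded `p`-variation -/

/-- The `p`-variation of `f` is at most `V`. The bound is required along all weakly monotone
sequences, so that it is inherited by `f ∘ τ` for every monotone `τ`. -/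
def HasPVariationLE {α : Type*} [Preorder α] (p V : ℝ) (f : α → ℝ) : Prop :=
  ∀ (n : ℕ) (u : ℕ → α), Monotone u →
    ∑ i ∈ Finset.range n, |f (u (i + 1)) - f (u i)| ^ p ≤ V ^ p

namespace HasPVariationLE

variable {α δ : Type*} [Preorder α] [Preorder δ] {p V W η : ℝ} {f g : α → ℝ}

theorem comp_monotone (hf : HasPVariationLE p V f) {τ : δ → α} (hτ : Monotone τ) :
    HasPVariationLE p V (f ∘ τ) :=
  fun n u hu => hf n (τ ∘ u) (hτ.comp hu)

theorem mono (hf : HasPVariationLE p V f) (hp : 0 ≤ p) (hV : 0 ≤ V) (hVW : V ≤ W) :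
    HasPVariationLE p W f :=
  fun n u hu => (hf n u hu).trans (Real.rpow_le_rpow hV hVW hp)

theorem abs_sub_le (hf : HasPVariationLE p V f) (hp : 0 < p) (hV : 0 ≤ V) {x y : α}
    (hxy : x ≤ y) : |f y - f x| ≤ V := by
  have hu : Monotone (fun i : ℕ => if i = 0 then x else y) := by
    refine monotone_nat_of_le_succ fun n => ?_
    rcases n with _ | n <;> simp [hxy]
  have h := hf 1 _ hu
  simp only [Finset.range_one, Finset.sum_singleton, zero_add, one_ne_zero, if_true,
    if_false] at h
  exact (Real.rpow_le_rpow_iff (abs_nonneg _) hV hp).1 h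

theorem neg (hf : HasPVariationLE p V f) : HasPVariationLE p V (fun x => -f x) := by
  intro n u hu
  refine le_of_eq_of_le (Finset.sum_congr rfl fun i _ => ?_) (hf n u hu)
  rw [← abs_neg]
  ring_nf

theorem add_const (hf : HasPVariationLE p V f) (c : ℝ) :
    HasPVariationLE p V (fun x => f x + c) := by
  intro n u hu
  simpa using hf n u hu

theorem sub (hp : 1 ≤ p) (hV : 0 ≤ V) (hf : HasPVariationLE p V f)
    (hg : HasPVariationLE p V g) : HasPVariationLE p (2 * V) (fun x => f x - g x) := by
  intro n u hu
  have hp0 : 0 < p := by linarith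
  have h := Real.Lp_add_le (Finset.range n) (fun i => f (u (i + 1)) - f (u i))
    (fun i => -(g (u (i + 1)) - g (u i))) hp
  simp only [abs_neg] at h
  have root : ∀ S : ℝ, 0 ≤ S → S ≤ V ^ p → S ^ (1 / p) ≤ V := fun S hS h => by
    rw [one_div, Real.rpow_inv_le_iff_of_pos hS hV hp0]
    exact h
  have h1 := root _ (Finset.sum_nonneg fun i _ => by positivity) (hf n u hu)
  have h2 := root _ (Finset.sum_nonneg fun i _ => by positivity) (hg n u hu)
  have h3 := h.trans (add_le_add h1 h2)
  rw [one_div, Real.rpow_inv_le_iff_of_pos (Finset.sum_nonneg fun i _ => by positivity)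
    (by positivity) hp0, ← two_mul] at h3
  refine le_of_eq_of_le (Finset.sum_congr rfl fun i _ => ?_) h3
  congr 2
  ring

/-- Interpolation between the `p`-variation and the supremum norm: the `2p`-variation is small
if the function is uniformly small. -/
theorem two_mul_of_abs_le (hf : HasPVariationLE p V f) (hp : 0 < p) (hV : 0 ≤ V)
    (hη : 0 ≤ η) (h : ∀ x, |f x| ≤ η) :
    HasPVariationLE (2 * p) (Real.sqrt (2 * η * V)) f := by
  intro n u hu
  have e : Real.sqrt (2 * η * V) ^ (2 * p) = (2 * η) ^ p * V ^ p := by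
    rw [Real.rpow_mul (Real.sqrt_nonneg _), ← Real.mul_rpow (by positivity) hV]
    norm_num
    rw [Real.sq_sqrt (by positivity)]
  rw [e]
  calc ∑ i ∈ Finset.range n, |f (u (i + 1)) - f (u i)| ^ (2 * p)
      ≤ ∑ i ∈ Finset.range n, (2 * η) ^ p * |f (u (i + 1)) - f (u i)| ^ p := by
        refine Finset.sum_le_sum fun i _ => ?_
        rw [two_mul p, Real.rpow_add_of_nonneg (abs_nonneg _) hp.le hp.le]
        gcongr
        have := abs_le.1 (h (u (i + 1)))
        have := abs_le.1 (h (u i))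
        rw [abs_le]
        constructor <;> linarith
    _ ≤ _ := by
        rw [← Finset.mul_sum]
        gcongr
        exact hf n u hu

end HasPVariationLE

/-! ### Sums over consecutive cells -/

/-- The Riemann–Stieltjes sum over the `N` consecutive cells with division points
`0, 1, …, N`: the `i`-th cell, from `i` to `i + 1`, carries the value `a (i + 1)`, and `b` is the
integrator. The values `a 0` and `a (N + 1)` lie to the left and to the right of all cells. -/
def cellSum (a b : ℕ → ℝ) (N : ℕ) : ℝ :=
  ∑ i ∈ Finset.range N, a (i + 1) * (b (i + 1) - b i)

theorem cellSum_sub_const_mul (a b x : ℕ → ℝ) (m : ℝ) (N : ℕ) :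
    cellSum a (fun i => b i - m * x i) N = cellSum a b N - m * cellSum a x N := by
  simp only [cellSum, Finset.mul_sum, ← Finset.sum_sub_distrib]
  exact Finset.sum_congr rfl fun i _ => by ring

/-- The strictly monotone map `ℕ → ℕ` that omits the value `k`. -/
def omitIndex (k i : ℕ) : ℕ := if i < k then i else i + 1

theorem omitIndex_monotone (k : ℕ) : Monotone (omitIndex k) := by
  intro i j hij
  unfold omitIndex
  split_ifs <;> omega

/-- Merging the adjacent cells `j` and `j + 1`: the division point `j + 1` is omitted, and the
new cell carries one of the two old values. -/
theorem cellSum_merge (a b : ℕ → ℝ) {j m k : ℕ} (hj : j < m) (hk : k = j + 1 ∨ k = j + 2) :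
    cellSum a b (m + 1) = cellSum (a ∘ omitIndex k) (b ∘ omitIndex (j + 1)) m
      + (a (j + 1) - a (omitIndex k (j + 1))) * (b (j + 1) - b j)
      + (a (j + 2) - a (omitIndex k (j + 1))) * (b (j + 2) - b (j + 1)) := by
  obtain ⟨r, rfl⟩ : ∃ r, m = j + 1 + r := ⟨m - (j + 1), by omega⟩
  have h1 : cellSum a b (j + 1 + r + 1) = (∑ i ∈ Finset.range j, a (i + 1) * (b (i + 1) - b i))
      + a (j + 1) * (b (j + 1) - b j) + a (j + 2) * (b (j + 2) - b (j + 1))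
      + ∑ i ∈ Finset.range r, a (j + 2 + i + 1) * (b (j + 2 + i + 1) - b (j + 2 + i)) := by
    rw [cellSum, show j + 1 + r + 1 = j + 2 + r by ring, Finset.sum_range_add,
      Finset.sum_range_succ, Finset.sum_range_succ]
  have h2 : cellSum (a ∘ omitIndex k) (b ∘ omitIndex (j + 1)) (j + 1 + r) =
      (∑ i ∈ Finset.range j, a (i + 1) * (b (i + 1) - b i))
      + a (omitIndex k (j + 1)) * (b (j + 2) - b j)
      + ∑ i ∈ Finset.range r, a (j + 2 + i + 1) * (b (j + 2 + i + 1) - b (j + 2 + i)) := by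
    rw [cellSum, Finset.sum_range_add, Finset.sum_range_succ]
    congr 1
    · congr 1
      · refine Finset.sum_congr rfl fun i hi => ?_
        have := Finset.mem_range.1 hi
        have e1 : omitIndex k (i + 1) = i + 1 := by unfold omitIndex; rw [if_pos]; omega
        have e2 : omitIndex (j + 1) (i + 1) = i + 1 := by unfold omitIndex; rw [if_pos]; omega
        have e3 : omitIndex (j + 1) i = i := by unfold omitIndex; rw [if_pos]; omega
        simp [e1, e2, e3]
      · have e2 : omitIndex (j + 1) (j + 1) = j + 2 := by simp [omitIndex]
        have e3 : omitIndex (j + 1) j = j := by simp [omitIndex]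
        simp [e2, e3]
    · refine Finset.sum_congr rfl fun i _ => ?_
      have e1 : omitIndex k (j + 1 + i + 1) = j + 2 + i + 1 := by
        unfold omitIndex; rw [if_neg] <;> omega
      have e2 : omitIndex (j + 1) (j + 1 + i + 1) = j + 2 + i + 1 := by
        unfold omitIndex; rw [if_neg] <;> omega
      have e3 : omitIndex (j + 1) (j + 1 + i) = j + 2 + i := by
        unfold omitIndex; rw [if_neg] <;> omega
      simp [e1, e2, e3]
  rw [h1, h2]
  ring

/-- Summation by parts: if the integrator `g` never increases by more than `b`, the sum is at most
`b` times the total increase of the values. The number `m` in the induction stands for the minimum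
of `g` so far. -/
theorem cellSum_le_mul_sum_posPart {a g : ℕ → ℝ} {b : ℝ} (ha : ∀ i, 0 ≤ a i) (ha0 : a 0 = 0)
    (hg : ∀ i j, i ≤ j → g j - g i ≤ b) (N : ℕ) :
    cellSum a g N ≤ b * ∑ i ∈ Finset.range N, max (a (i + 1) - a i) 0 := by
  suffices H : ∃ m, (∀ j, N ≤ j → g j ≤ m + b) ∧ m ≤ g N ∧
      cellSum a g N ≤ b * ∑ i ∈ Finset.range N, max (a (i + 1) - a i) 0
        - a N * (b - (g N - m)) by
    obtain ⟨m, h1, -, h3⟩ := H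
    have := mul_nonneg (ha N) (show 0 ≤ b - (g N - m) by linarith [h1 N le_rfl])
    linarith
  induction N with
  | zero =>
    refine ⟨g 0, fun j hj => by linarith [hg 0 j hj], le_rfl, ?_⟩
    simp [cellSum, ha0]
  | succ N ih =>
    obtain ⟨m, h1, h2, h3⟩ := ih
    refine ⟨min m (g (N + 1)), fun j hj => ?_, min_le_right _ _, ?_⟩
    · rcases min_choice m (g (N + 1)) with h | h <;> rw [h]
      · exact h1 j (by omega)
      · linarith [hg _ _ hj]
    · have e : cellSum a g (N + 1) = cellSum a g N + a (N + 1) * (g (N + 1) - g N) := by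
        simp [cellSum, Finset.sum_range_succ]
      rw [e, Finset.sum_range_succ, mul_add]
      have hm : a (N + 1) * min m (g (N + 1)) ≤ a (N + 1) * m :=
        mul_le_mul_of_nonneg_left (min_le_left _ _) (ha _)
      have h4 : 0 ≤ b - g N + m := by linarith [h1 N le_rfl]
      have h5 : (a (N + 1) - a N) * (b - g N + m) ≤ max (a (N + 1) - a N) 0 * b :=
        (mul_le_mul_of_nonneg_right (le_max_left _ 0) h4).trans
          (mul_le_mul_of_nonneg_left (by linarith) (le_max_right _ _))
      nlinarith

/-! ### Concave moduli -/

theorem ConcaveOn.monotoneOn_of_nonneg {ω : ℝ → ℝ} (hω : ConcaveOn ℝ (Ici 0) ω)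
    (h0 : ∀ h ≥ 0, 0 ≤ ω h) : MonotoneOn ω (Ici 0) := by
  intro x hx y hy hxy
  by_contra! hlt
  have hxy' : x < y := lt_of_le_of_ne hxy (by rintro rfl; exact lt_irrefl _ hlt)
  -- beyond `y` the graph stays below the decreasing secant, which becomes negative
  set z := y + (ω y + 1) * (y - x) / (ω x - ω y) with hz
  have hd : 0 < ω x - ω y := by linarith
  have hy0 := h0 y hy
  have hyz : y < z := by
    have : 0 < (ω y + 1) * (y - x) / (ω x - ω y) := by
      have : 0 < y - x := by linarith
      positivity
    linarith
  have hz0 : (0:ℝ) ≤ z := le_trans hy hyz.le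
  have h := hω.slope_anti_adjacent hx hz0 hxy' hyz
  rw [div_le_div_iff₀ (by linarith) (by linarith)] at h
  have e : (z - y) * (ω x - ω y) = (ω y + 1) * (y - x) := by
    rw [hz]; field_simp; ring
  have h5 : (ω z + 1) * (y - x) ≤ 0 := by nlinarith
  have := h0 z hz0
  have : 0 < y - x := by linarith
  nlinarith

theorem ConcaveOn.apply_mul_le_mul_apply {ω : ℝ → ℝ} (hω : ConcaveOn ℝ (Ici 0) ω)
    (h0 : ∀ h ≥ 0, 0 ≤ ω h) {k t : ℝ} (hk : 1 ≤ k) (ht : 0 ≤ t) : ω (k * t) ≤ k * ω t := by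
  have hk0 : 0 < k := by linarith
  have h := hω.2 (show (0:ℝ) ∈ Ici 0 by simp) (show k * t ∈ Ici 0 from by
    simp only [mem_Ici]; positivity) (show 0 ≤ 1 - 1 / k by
      rw [sub_nonneg, div_le_one hk0]; exact hk) (show 0 ≤ 1 / k by positivity) (by ring)
  simp only [smul_eq_mul, mul_zero, zero_add] at h
  rw [show 1 / k * (k * t) = t by field_simp] at h
  have h1 : 0 ≤ (1 - 1 / k) * ω 0 := by
    refine mul_nonneg ?_ (h0 0 le_rfl)
    rw [sub_nonneg, div_le_one hk0]; exact hk
  have h2 : 1 / k * ω (k * t) ≤ ω t := by linarith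
  calc ω (k * t) = k * (1 / k * ω (k * t)) := by field_simp
    _ ≤ _ := by gcongr

/-- A nonnegative concave function on `[0, ∞)` lies below an affine function that touches it at a
given point, with nonnegative coefficients. -/
theorem ConcaveOn.exists_affine_majorant {ω : ℝ → ℝ} (hω : ConcaveOn ℝ (Ici 0) ω)
    (h0 : ∀ h ≥ 0, 0 ≤ ω h) {t : ℝ} (ht : 0 < t) :
    ∃ m b : ℝ, 0 ≤ m ∧ 0 ≤ b ∧ (∀ h ≥ 0, ω h ≤ m * h + b) ∧ m * t + b = ω t := by
  have hmono := hω.monotoneOn_of_nonneg h0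
  -- the slope `m` is the right derivative at `t`; the lemmas on convex functions are used for `-ω`
  have hti : t ∈ interior (Ici (0:ℝ)) := by simpa using ht
  set m := derivWithin ω (Ioi t) t with hm
  have hneg := hω.neg
  have hmn : derivWithin (-ω) (Ioi t) t = -m := by simp [hm, derivWithin.neg]
  have key : ∀ h ≥ 0, ω h ≤ ω t + m * (h - t) := by
    intro h hh
    rcases lt_trichotomy h t with hlt | rfl | hgt
    · have h1 := hneg.slope_le_leftDeriv_of_mem_interior hh hti hlt
      have h2 := hneg.leftDeriv_le_rightDeriv_of_mem_interior hti
      rw [hmn] at h2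
      have h3 := h1.trans h2
      rw [slope_def_field, div_le_iff₀ (by linarith)] at h3
      simp only [Pi.neg_apply] at h3
      linarith
    · simp
    · have h1 := hneg.rightDeriv_le_slope_of_mem_interior hti hh hgt
      rw [hmn, slope_def_field, le_div_iff₀ (by linarith)] at h1
      simp only [Pi.neg_apply] at h1
      linarith
  have hm0 : 0 ≤ m := by
    have h1 := key (t + 1) (by linarith)
    have h2 := hmono (show t ∈ Ici (0:ℝ) from ht.le) (show t + 1 ∈ Ici (0:ℝ) by
      simp only [mem_Ici]; linarith) (by linarith)
    linarith
  refine ⟨m, ω t - m * t, hm0, ?_, fun h hh => by linarith [key h hh], by ring⟩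
  linarith [key 0 le_rfl, h0 0 le_rfl]

/-! ### Coarsening a partition -/

/-- Among `m` pairs of adjacent cells there is one which is short and across which the values vary
little. -/
theorem exists_short_pair_small_oscillation {p V L : ℝ} (hV : 0 < V) (hL : 0 < L)
    {a x : ℕ → ℝ} (hx : Monotone x) {m : ℕ} (hm : 1 ≤ m)
    (hxL : x (m + 1) - x 0 ≤ L) (ha : HasPVariationLE p V a) :
    ∃ j < m, |a (j + 2) - a (j + 1)| ^ p ≤ V ^ p * (2 / m) ∧ x (j + 2) - x j ≤ 4 * L / m := by
  have hm0 : (0:ℝ) < m := by exact_mod_cast hm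
  have hVp : 0 < V ^ p := Real.rpow_pos_of_pos hV p
  have h1 : ∑ j ∈ Finset.range m, |a (j + 2) - a (j + 1)| ^ p ≤ V ^ p :=
    ha m (fun i => i + 1) (fun i j h => by simpa using h)
  have h2 : ∑ j ∈ Finset.range m, (x (j + 2) - x j) ≤ 2 * L := by
    have e1 := Finset.sum_range_sub x m
    have e2 := Finset.sum_range_sub (fun i => x (i + 1)) m
    have e3 : ∑ j ∈ Finset.range m, (x (j + 2) - x j) =
        ∑ j ∈ Finset.range m, (x (j + 1 + 1) - x (j + 1))
          + ∑ j ∈ Finset.range m, (x (j + 1) - x j) := by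
      rw [← Finset.sum_add_distrib]
      exact Finset.sum_congr rfl fun i _ => by ring_nf
    have := hx (show 0 ≤ 0 + 1 by omega)
    have := hx (show m ≤ m + 1 by omega)
    rw [e3, e1, e2]
    linarith
  obtain ⟨j, hj, hle⟩ := Finset.exists_le_of_sum_le (s := Finset.range m)
    (f := fun j => |a (j + 2) - a (j + 1)| ^ p / V ^ p + (x (j + 2) - x j) / (2 * L))
    (g := fun _ => 2 / (m:ℝ)) (by simpa using by omega) (by
      rw [Finset.sum_add_distrib, ← Finset.sum_div, ← Finset.sum_div]
      simp only [Finset.sum_const, Finset.card_range, nsmul_eq_mul]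
      rw [mul_div_cancel₀ _ hm0.ne']
      have := (div_le_one hVp).2 h1
      have := (div_le_one (by positivity : 0 < 2 * L)).2 h2
      linarith)
  have hA : 0 ≤ |a (j + 2) - a (j + 1)| ^ p / V ^ p := by positivity
  have hB : 0 ≤ (x (j + 2) - x j) / (2 * L) :=
    div_nonneg (sub_nonneg.2 (hx (by omega))) (by positivity)
  refine ⟨j, Finset.mem_range.1 hj, ?_, ?_⟩
  · have : |a (j + 2) - a (j + 1)| ^ p / V ^ p ≤ 2 / m := by linarith
    rw [div_le_iff₀ hVp] at this
    linarith
  · have : (x (j + 2) - x j) / (2 * L) ≤ 2 / m := by linarith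
    rw [div_le_iff₀ (by positivity)] at this
    calc _ ≤ _ := this
      _ = _ := by ring

/-- One merging step. Replacing the values on two adjacent cells by the smaller one lowers the sum
by at most the jump between the two values times the increment of `β` over the cell carrying the
larger value, and only an upper bound of that increment is needed. -/
theorem exists_merge {p V L : ℝ} (hp : 0 < p) (hV : 0 < V) (hL : 0 < L) {ω β : ℝ → ℝ}
    (hmono : MonotoneOn ω (Ici 0)) (hβ : ∀ x y, y ≤ x → β x - β y ≤ ω (x - y))
    {a x : ℕ → ℝ} (hx : Monotone x) {m : ℕ} (hm : 1 ≤ m) (hxL : x (m + 1) - x 0 ≤ L)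
    (ha : HasPVariationLE p V a) :
    ∃ ρ σ : ℕ → ℕ, Monotone ρ ∧ Monotone σ ∧ ρ 0 = 0 ∧ ρ m = m + 1 ∧ σ 0 = 0 ∧
      σ (m + 1) = m + 2 ∧
      cellSum a (β ∘ x) (m + 1) ≤ cellSum (a ∘ σ) (β ∘ x ∘ ρ) m
        + V * (2 / m) ^ (1 / p) * ω (4 * L / m) ∧
      cellSum (a ∘ σ) (x ∘ ρ) m ≤ cellSum a x (m + 1) := by
  obtain ⟨j, hj, hA, hB⟩ := exists_short_pair_small_oscillation hV hL hx hm hxL ha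
  have hm0 : (0:ℝ) < m := by exact_mod_cast hm
  have hA' : |a (j + 2) - a (j + 1)| ≤ V * (2 / m) ^ (1 / p) := by
    rw [← Real.rpow_le_rpow_iff (abs_nonneg _) (by positivity) hp,
      Real.mul_rpow hV.le (by positivity), ← Real.rpow_mul (by positivity),
      one_div_mul_cancel hp.ne', Real.rpow_one]
    exact hA
  have x01 := hx (show j ≤ j + 1 by omega)
  have x12 := hx (show j + 1 ≤ j + 2 by omega)
  have hω : ∀ s t, s ≤ t → t - s ≤ x (j + 2) - x j → β t - β s ≤ ω (4 * L / m) :=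
    fun s t hst h => (hβ t s hst).trans (hmono (sub_nonneg.2 hst)
      (show (0:ℝ) ≤ 4 * L / m by positivity) (h.trans hB))
  have step : ∀ d e : ℝ, 0 ≤ d → d ≤ V * (2 / m) ^ (1 / p) → e ≤ ω (4 * L / m) →
      d * e ≤ V * (2 / m) ^ (1 / p) * ω (4 * L / m) := by
    intro d e hd hd' he
    have : 0 ≤ ω (4 * L / m) := by
      have h1 := hβ 0 0 le_rfl
      have h2 := hmono (show (0:ℝ) ∈ Ici 0 by simp)
        (show (0:ℝ) ≤ 4 * L / m by positivity) (by positivity)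
      simp only [sub_self] at h1
      linarith
    exact (mul_le_mul_of_nonneg_left he hd).trans (mul_le_mul_of_nonneg_right hd' this)
  have common : ∀ k, (k = j + 1 ∨ k = j + 2) → Monotone (omitIndex (j + 1)) ∧
      Monotone (omitIndex k) ∧ omitIndex (j + 1) 0 = 0 ∧ omitIndex (j + 1) m = m + 1 ∧
      omitIndex k 0 = 0 ∧ omitIndex k (m + 1) = m + 2 := by
    intro k hk
    refine ⟨omitIndex_monotone _, omitIndex_monotone _, ?_, ?_, ?_, ?_⟩ <;> unfold omitIndex
    · simp
    · rw [if_neg (by omega)]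
    · rw [if_pos (by omega)]
    · rw [if_neg (by omega)]
  rcases le_total (a (j + 1)) (a (j + 2)) with h | h
  · obtain ⟨c1, c2, c3, c4, c5, c6⟩ := common (j + 2) (Or.inr rfl)
    have hk : omitIndex (j + 2) (j + 1) = j + 1 := by unfold omitIndex; rw [if_pos (by omega)]
    refine ⟨_, _, c1, c2, c3, c4, c5, c6, ?_, ?_⟩
    · rw [cellSum_merge a (β ∘ x) hj (Or.inr rfl), hk]
      have := step (a (j + 2) - a (j + 1)) (β (x (j + 2)) - β (x (j + 1))) (by linarith)
        ((le_abs_self _).trans hA') (hω _ _ x12 (by linarith))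
      simp only [Function.comp_apply, sub_self, zero_mul, add_zero]
      simp only [Function.comp_def] at this ⊢
      linarith
    · rw [cellSum_merge a x hj (Or.inr rfl), hk]
      have := mul_nonneg (sub_nonneg.2 h) (sub_nonneg.2 x12)
      linarith
  · obtain ⟨c1, c2, c3, c4, c5, c6⟩ := common (j + 1) (Or.inl rfl)
    have hk : omitIndex (j + 1) (j + 1) = j + 2 := by unfold omitIndex; rw [if_neg (by omega)]
    refine ⟨_, _, c1, c2, c3, c4, c5, c6, ?_, ?_⟩
    · rw [cellSum_merge a (β ∘ x) hj (Or.inl rfl), hk]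
      have := step (a (j + 1) - a (j + 2)) (β (x (j + 1)) - β (x j)) (by linarith)
        ((le_abs_self _).trans (by rw [abs_sub_comm]; exact hA')) (hω _ _ x01 (by linarith))
      simp only [Function.comp_apply, sub_self, zero_mul, add_zero]
      simp only [Function.comp_def] at this ⊢
      linarith
    · rw [cellSum_merge a x hj (Or.inl rfl), hk]
      have := mul_nonneg (sub_nonneg.2 h) (sub_nonneg.2 x01)
      linarith

/-- Merging cells until at most `n` are left. The coarse values and division points are
subsequences of the original ones. -/
theorem exists_coarsening {p V L : ℝ} (hp : 0 < p) (hV : 0 < V) (hL : 0 < L) {ω β : ℝ → ℝ}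
    (hmono : MonotoneOn ω (Ici 0)) (hβ : ∀ x y, y ≤ x → β x - β y ≤ ω (x - y))
    {n : ℕ} (hn : 1 ≤ n) (N : ℕ) {a x : ℕ → ℝ} (hx : Monotone x) (hxL : x N - x 0 ≤ L)
    (ha : HasPVariationLE p V a) :
    ∃ M ≤ n, ∃ ρ σ : ℕ → ℕ, Monotone ρ ∧ Monotone σ ∧ ρ 0 = 0 ∧ ρ M = N ∧ σ 0 = 0 ∧
      σ (M + 1) = N + 1 ∧
      cellSum a (β ∘ x) N ≤ cellSum (a ∘ σ) (β ∘ x ∘ ρ) M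
        + ∑ m ∈ Finset.Ico n N, V * (2 / m) ^ (1 / p) * ω (4 * L / m) ∧
      cellSum (a ∘ σ) (x ∘ ρ) M ≤ cellSum a x N := by
  induction N generalizing a x with
  | zero =>
    exact ⟨0, by omega, id, id, monotone_id, monotone_id, rfl, rfl, rfl, rfl, by simp, by simp⟩
  | succ N ih =>
    rcases Nat.lt_or_ge N n with hlt | hge
    · refine ⟨N + 1, by omega, id, id, monotone_id, monotone_id, rfl, rfl, rfl, rfl, ?_,
        by simp⟩
      rw [Finset.Ico_eq_empty (by omega)]
      simp
    · obtain ⟨ρ, σ, hρ, hσ, hρ0, hρN, hσ0, hσN, h1, h2⟩ :=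
        exists_merge hp hV hL hmono hβ hx (hn.trans hge) hxL ha
      obtain ⟨M, hM, ρ', σ', hρ', hσ', hρ0', hρN', hσ0', hσN', h1', h2'⟩ :=
        ih (a := a ∘ σ) (x := x ∘ ρ) (hx.comp hρ) (by simpa [hρ0, hρN] using hxL)
          (ha.comp_monotone hσ)
      refine ⟨M, hM, ρ ∘ ρ', σ ∘ σ', hρ.comp hρ', hσ.comp hσ', by simp [hρ0, hρ0'],
        by simp [hρN, hρN'], by simp [hσ0, hσ0'], by simp [hσN, hσN'], ?_, h2'.trans h2⟩
      rw [Finset.sum_Ico_succ_top hge]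
      simp only [Function.comp_assoc] at h1' h1 ⊢
      linarith

/-! ### Estimates for sums over cells -/

theorem rpow_neg_sub_rpow_neg_succ_ge {s : ℝ} (hs : 0 < s) (hs1 : s ≤ 1) {m : ℕ} (hm : 1 ≤ m) :
    (m : ℝ) ^ (-(1 + s)) ≤ 4 / s * ((m : ℝ) ^ (-s) - ((m + 1 : ℕ) : ℝ) ^ (-s)) := by
  have hm0 : (1:ℝ) ≤ m := by exact_mod_cast hm
  have hm1 : (0:ℝ) < m := by linarith
  push_cast
  have hq : (m:ℝ) ^ (-s) = ((m:ℝ) + 1) ^ (-s) * ((m:ℝ) / (m + 1)) ^ (-s) := by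
    rw [← Real.mul_rpow (by positivity) (by positivity)]
    congr 1; field_simp
  have h1 : 1 + s / (m + 1) ≤ ((m:ℝ) / (m + 1)) ^ (-s) := by
    rw [Real.rpow_def_of_pos (by positivity)]
    have h := Real.log_le_sub_one_of_pos (show 0 < (m:ℝ) / (m + 1) by positivity)
    have e : (m:ℝ) / (m + 1) - 1 = -(1 / (m + 1)) := by field_simp; ring
    rw [e] at h
    have h2 : s / (m + 1) ≤ Real.log ((m:ℝ) / (m + 1)) * -s := by
      have := mul_le_mul_of_nonneg_left h hs.le
      rw [show s / ((m:ℝ) + 1) = s * (1 / (m + 1)) by ring]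
      linarith
    linarith [Real.add_one_le_exp (Real.log ((m:ℝ) / (m + 1)) * -s)]
  have h2 : s * ((m:ℝ) + 1) ^ (-(1 + s)) ≤ (m : ℝ) ^ (-s) - ((m:ℝ) + 1) ^ (-s) := by
    rw [hq]
    have e : ((m:ℝ) + 1) ^ (-(1 + s)) = ((m:ℝ) + 1) ^ (-s) * (1 / (m + 1)) := by
      rw [show -(1 + s) = -s + -1 by ring, Real.rpow_add (by positivity), Real.rpow_neg_one,
        one_div]
    rw [e]
    have := mul_le_mul_of_nonneg_left h1 (show 0 ≤ ((m:ℝ) + 1) ^ (-s) by positivity)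
    calc _ = ((m:ℝ) + 1) ^ (-s) * (1 + s / (m + 1)) - ((m:ℝ) + 1) ^ (-s) := by ring
      _ ≤ _ := by linarith
  have h3 : (m:ℝ) ^ (-(1 + s)) ≤ 4 * ((m:ℝ) + 1) ^ (-(1 + s)) := by
    have e : (m:ℝ) ^ (-(1 + s)) = 2 ^ (1 + s) * (2 * (m:ℝ)) ^ (-(1 + s)) := by
      rw [Real.mul_rpow (by norm_num) hm1.le, ← mul_assoc, ← Real.rpow_add (by norm_num)]
      simp
    have e1 : (2:ℝ) ^ (1 + s) ≤ 4 := by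
      calc (2:ℝ) ^ (1 + s) ≤ 2 ^ (2:ℝ) :=
            Real.rpow_le_rpow_of_exponent_le (by norm_num) (by linarith)
        _ = 4 := by norm_num
    have e2 : (2 * (m:ℝ)) ^ (-(1 + s)) ≤ ((m:ℝ) + 1) ^ (-(1 + s)) :=
      Real.rpow_le_rpow_of_nonpos (by positivity) (by linarith) (by linarith)
    rw [e]
    exact mul_le_mul e1 e2 (by positivity) (by norm_num)
  calc _ ≤ _ := h3
    _ = 4 / s * (s * ((m:ℝ) + 1) ^ (-(1 + s))) := by field_simp
    _ ≤ _ := by gcongr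

theorem sum_Ico_rpow_neg_le {s : ℝ} (hs : 0 < s) (hs1 : s ≤ 1) {n : ℕ} (hn : 1 ≤ n) (N : ℕ) :
    ∑ m ∈ Finset.Ico n N, (m : ℝ) ^ (-(1 + s)) ≤ 4 / s * (n : ℝ) ^ (-s) := by
  rcases le_or_gt N n with h | h
  · rw [Finset.Ico_eq_empty (by omega)]
    simp only [Finset.sum_empty]
    positivity
  calc _ ≤ ∑ m ∈ Finset.Ico n N, 4 / s * ((m : ℝ) ^ (-s) - ((m + 1 : ℕ) : ℝ) ^ (-s)) :=
        Finset.sum_le_sum fun m hm =>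
          rpow_neg_sub_rpow_neg_succ_ge hs hs1 (hn.trans (Finset.mem_Ico.1 hm).1)
    _ = 4 / s * ((n : ℝ) ^ (-s) - (N : ℝ) ^ (-s)) := by
        rw [← Finset.mul_sum, Finset.sum_Ico_eq_sum_range]
        have := Finset.sum_range_sub' (fun i => ((n + i : ℕ) : ℝ) ^ (-s)) (N - n)
        simp only [add_zero, ← add_assoc] at this
        rw [this, show n + (N - n) = N by omega]
    _ ≤ _ := by
        have : 0 ≤ (N:ℝ) ^ (-s) := by positivity
        gcongr
        linarith

/-- The total loss in coarsening to `n` cells. The series over the number of cells converges since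
the Hölder exponent `1 - 1 / (2 p)` exceeds `1 - 1 / p`. -/
theorem sum_coarsening_loss_le {p : ℝ} (hp : 1 ≤ p) {ω : ℝ → ℝ} (hω : ConcaveOn ℝ (Ici 0) ω)
    (h0 : ∀ h ≥ 0, 0 ≤ ω h) {C : ℝ} (hC : ∀ h ∈ Ioo (0 : ℝ) 1, ω h ≤ C * h ^ (1 - 1 / (2 * p)))
    (hC0 : 0 ≤ C) {L : ℝ} (hL : 0 < L) {n : ℕ} (hn : 1 ≤ n) (hLn : L < 2 * n) (N : ℕ) :
    ∑ m ∈ Finset.Ico n N, (2 / (m : ℝ)) ^ (1 / p) * ω (4 * L / m)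
      ≤ 128 * p * C * (L ^ (1 - 1 / (2 * p)) * (n : ℝ) ^ (-(1 / (2 * p)))) := by
  have hp0 : 0 < p := by linarith
  have hs1 : 1 / (2 * p) ≤ 1 := by rw [div_le_one (by positivity)]; linarith
  have hα : 0 ≤ 1 - 1 / (2 * p) := by linarith
  have hip : 1 / p ≤ 1 := by rw [div_le_one hp0]; exact hp
  have term : ∀ m ∈ Finset.Ico n N, (2 / (m : ℝ)) ^ (1 / p) * ω (4 * L / m)
      ≤ 16 * C * L ^ (1 - 1 / (2 * p)) * (m : ℝ) ^ (-(1 + 1 / (2 * p))) := by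
    intro m hm
    have hnm := (Finset.mem_Ico.1 hm).1
    have hm0 : (0:ℝ) < m := by exact_mod_cast (by omega : 0 < m)
    have hnm' : (n:ℝ) ≤ m := by exact_mod_cast hnm
    have h1 : (2 / (m : ℝ)) ^ (1 / p) ≤ 2 * (m:ℝ) ^ (-(1 / p)) := by
      rw [Real.div_rpow (by norm_num) hm0.le, Real.rpow_neg hm0.le, div_eq_mul_inv]
      gcongr
      calc (2:ℝ) ^ (1 / p) ≤ 2 ^ (1:ℝ) :=
            Real.rpow_le_rpow_of_exponent_le (by norm_num) hip
        _ = 2 := by norm_num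
    have h2 : ω (4 * L / m) ≤ 8 * (C * (L ^ (1 - 1 / (2 * p)) * (m:ℝ) ^ (-(1 - 1 / (2 * p))))) := by
      -- `4 * L / m` may exceed `1`, where no Hölder bound is available, but an eighth of it does not
      have hmem : L / (2 * m) ∈ Ioo (0:ℝ) 1 :=
        ⟨by positivity, by rw [div_lt_one (by positivity)]; linarith⟩
      have h3 := hω.apply_mul_le_mul_apply h0 (show (1:ℝ) ≤ 8 by norm_num) hmem.1.le
      rw [show 8 * (L / (2 * (m:ℝ))) = 4 * L / m by field_simp; ring] at h3
      refine h3.trans ?_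
      gcongr
      refine (hC _ hmem).trans ?_
      gcongr
      rw [Real.rpow_neg hm0.le, ← div_eq_mul_inv, ← Real.div_rpow hL.le hm0.le]
      gcongr
      linarith
    calc _ ≤ (2 * (m:ℝ) ^ (-(1 / p))) *
          (8 * (C * (L ^ (1 - 1 / (2 * p)) * (m:ℝ) ^ (-(1 - 1 / (2 * p)))))) := by
          gcongr
          exact h0 _ (by positivity)
      _ = 16 * C * L ^ (1 - 1 / (2 * p)) *
          ((m:ℝ) ^ (-(1 / p)) * (m:ℝ) ^ (-(1 - 1 / (2 * p)))) := by ring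
      _ = _ := by
          rw [← Real.rpow_add hm0]
          congr 2
          field_simp
          ring
  calc _ ≤ _ := Finset.sum_le_sum term
    _ = 16 * C * L ^ (1 - 1 / (2 * p)) *
        ∑ m ∈ Finset.Ico n N, (m : ℝ) ^ (-(1 + 1 / (2 * p))) := by rw [← Finset.mul_sum]
    _ ≤ 16 * C * L ^ (1 - 1 / (2 * p)) * (4 / (1 / (2 * p)) * (n : ℝ) ^ (-(1 / (2 * p)))) := by
        gcongr
        exact sum_Ico_rpow_neg_le (by positivity) hs1 hn N
    _ = _ := by field_simp; ring

/-- Half of the total variation of a finite sequence that starts and ends at zero. -/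
theorem sum_posPart_le_of_pVariation {p V : ℝ} (hp : 1 ≤ p) (hV : 0 ≤ V) {a : ℕ → ℝ}
    (ha : HasPVariationLE p V a) (a0 : a 0 = 0) {M : ℕ} (aM : a (M + 1) = 0) :
    ∑ i ∈ Finset.range M, max (a (i + 1) - a i) 0 ≤ 1 / 2 * ((M : ℝ) + 1) ^ (1 - 1 / p) * V := by
  have hp0 : 0 < p := by linarith
  set T := ∑ i ∈ Finset.range (M + 1), |a (i + 1) - a i| with hT
  have hT0 : 0 ≤ T := Finset.sum_nonneg fun i _ => abs_nonneg _
  have h1 : ∑ i ∈ Finset.range (M + 1), max (a (i + 1) - a i) 0 = 1 / 2 * T := by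
    have e : ∀ t : ℝ, max t 0 = 1 / 2 * (|t| + t) := by
      intro t
      rcases le_total t 0 with h | h
      · rw [max_eq_right h, abs_of_nonpos h]; ring
      · rw [max_eq_left h, abs_of_nonneg h]; ring
    simp only [e]
    rw [← Finset.mul_sum, Finset.sum_add_distrib, Finset.sum_range_sub, a0, aM]
    simp [hT]
  have h2 : T ≤ ((M : ℝ) + 1) ^ (1 - 1 / p) * V := by
    rw [← Real.rpow_le_rpow_iff hT0 (by positivity) hp0]
    have h3 := Real.rpow_sum_le_const_mul_sum_rpow (Finset.range (M + 1))
      (fun i => a (i + 1) - a i) hp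
    rw [Real.mul_rpow (by positivity) hV, ← Real.rpow_mul (by positivity),
      show (1 - 1 / p) * p = p - 1 by field_simp]
    refine h3.trans ?_
    simp only [Finset.card_range, Nat.cast_add, Nat.cast_one]
    gcongr
    exact ha (M + 1) id monotone_id
  have h3 : ∑ i ∈ Finset.range M, max (a (i + 1) - a i) 0 ≤
      ∑ i ∈ Finset.range (M + 1), max (a (i + 1) - a i) 0 := by
    rw [Finset.sum_range_succ]
    linarith [le_max_right (a (M + 1) - a M) 0]
  rw [h1] at h3
  linarith

/-- A crude bound for `cellSum`, linear in the `p`-variation and the supremum of the values. -/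
theorem exists_cellSum_le_linear {p : ℝ} (hp : 1 ≤ p) {ω : ℝ → ℝ} (hω : ConcaveOn ℝ (Ici 0) ω)
    (h0 : ∀ h ≥ 0, 0 ≤ ω h) {C : ℝ} (hC : ∀ h ∈ Ioo (0 : ℝ) 1, ω h ≤ C * h ^ (1 - 1 / (2 * p)))
    (hC0 : 0 ≤ C) {β : ℝ → ℝ} (hβ : ∀ x y, y ≤ x → β x - β y ≤ ω (x - y)) {L : ℝ} (hL : 0 < L) :
    ∃ K : ℝ, 0 ≤ K ∧ ∀ (N : ℕ) (a x : ℕ → ℝ) (V A : ℝ), 0 < V → Monotone x → x N - x 0 ≤ L →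
      HasPVariationLE p V a → (∀ i, 0 ≤ a i) → (∀ i, a i ≤ A) →
      cellSum a (β ∘ x) N ≤ K * (V + A) := by
  have hp0 : 0 < p := by linarith
  have hmono := hω.monotoneOn_of_nonneg h0
  obtain ⟨n, hn⟩ := exists_nat_gt L
  have hn0 : (0:ℝ) < n := hL.trans hn
  have hn1 : 1 ≤ n := by exact_mod_cast hn0
  have hωL := h0 L hL.le
  set E := 128 * p * C * (L ^ (1 - 1 / (2 * p)) * (n : ℝ) ^ (-(1 / (2 * p)))) with hE
  have hE0 : 0 ≤ E := by positivity
  refine ⟨E + n * ω L, by positivity, ?_⟩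
  intro N a x V A hV hx hxL ha ha0 haA
  obtain ⟨M, hM, ρ, σ, hρ, hσ, hρ0, hρM, -, -, h1, -⟩ :=
    exists_coarsening hp0 hV hL hmono hβ hn1 N hx hxL ha
  have hA : 0 ≤ A := (ha0 0).trans (haA 0)
  have h2 : cellSum (a ∘ σ) (β ∘ x ∘ ρ) M ≤ n * (A * ω L) := by
    calc cellSum (a ∘ σ) (β ∘ x ∘ ρ) M ≤ ∑ i ∈ Finset.range M, A * ω L := by
          refine Finset.sum_le_sum fun i hi => ?_
          have hi' := Finset.mem_range.1 hi
          have m1 := hx (hρ (show i ≤ i + 1 by omega))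
          have m2 := hx (hρ (show i + 1 ≤ M by omega))
          have m3 := hx (hρ (show 0 ≤ i by omega))
          rw [hρM] at m2
          rw [hρ0] at m3
          have h3 : β (x (ρ (i + 1))) - β (x (ρ i)) ≤ ω L :=
            (hβ _ _ m1).trans (hmono (sub_nonneg.2 m1) hL.le (by linarith))
          simp only [Function.comp_apply]
          exact (mul_le_mul_of_nonneg_left h3 (ha0 _)).trans
            (mul_le_mul_of_nonneg_right (haA _) hωL)
      _ = M * (A * ω L) := by simp
      _ ≤ _ := by gcongr
  have h3 : ∑ m ∈ Finset.Ico n N, V * (2 / (m:ℝ)) ^ (1 / p) * ω (4 * L / m) ≤ V * E := by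
    have := sum_coarsening_loss_le hp hω h0 hC hC0 hL hn1 (by linarith) N
    calc _ = V * ∑ m ∈ Finset.Ico n N, (2 / (m:ℝ)) ^ (1 / p) * ω (4 * L / m) := by
          rw [Finset.mul_sum]
          exact Finset.sum_congr rfl fun i _ => by ring
      _ ≤ _ := by gcongr
  have h4 : 0 ≤ A * E := by positivity
  have h5 : 0 ≤ V * (n * ω L) := by positivity
  nlinarith

/-- The bound obtained by coarsening to `⌊y⌋` cells, for a real parameter `y`. The step function on
the coarse cells has total variation at most `2 V y ^ (1 - 1 / p)`. -/
theorem cellSum_le_of_coarsening {p : ℝ} (hp : 1 ≤ p) {ω : ℝ → ℝ} (hω : ConcaveOn ℝ (Ici 0) ω)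
    (h0 : ∀ h ≥ 0, 0 ≤ ω h) {C : ℝ} (hC : ∀ h ∈ Ioo (0 : ℝ) 1, ω h ≤ C * h ^ (1 - 1 / (2 * p)))
    (hC0 : 0 ≤ C) {β : ℝ → ℝ} (hβ : ∀ x y, y ≤ x → β x - β y ≤ ω (x - y))
    {V L S y : ℝ} (hV : 0 < V) (hL : 0 < L) (hS : 0 < S) (hy : 1 ≤ y) (hLy : L ≤ y)
    {N : ℕ} {a x : ℕ → ℝ} (hx : Monotone x) (hxL : x N - x 0 ≤ L) (ha : HasPVariationLE p V a)
    (hapos : ∀ i, 0 ≤ a i) (a0 : a 0 = 0) (aN : a (N + 1) = 0) (haS : cellSum a x N ≤ S) :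
    cellSum a (β ∘ x) N ≤ V * y ^ (1 - 1 / p) * ω (S / (V * y ^ (1 - 1 / p)))
      + V * (256 * p * C * (L ^ (1 - 1 / (2 * p)) * y ^ (-(1 / (2 * p))))) := by
  have hp0 : 0 < p := by linarith
  have hip : 0 ≤ 1 - 1 / p := by rw [sub_nonneg, div_le_one hp0]; exact hp
  have hip1 : 1 - 1 / p ≤ 1 := by linarith [show 0 < 1 / p by positivity]
  have hs1 : 1 / (2 * p) ≤ 1 := by rw [div_le_one (by positivity)]; linarith
  have hy0 : 0 < y := by linarith
  set P := V * y ^ (1 - 1 / p) with hP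
  have hP0 : 0 < P := by positivity
  obtain ⟨n, hny, hyn, hn1⟩ : ∃ n : ℕ, (n:ℝ) ≤ y ∧ y < n + 1 ∧ 1 ≤ n :=
    ⟨⌊y⌋₊, Nat.floor_le hy0.le, Nat.lt_floor_add_one y, Nat.one_le_floor_iff y |>.2 hy⟩
  have hn1' : (1:ℝ) ≤ n := by exact_mod_cast hn1
  obtain ⟨M, hM, ρ, σ, hρ, hσ, hρ0, hρM, hσ0, hσM, h1, h2⟩ :=
    exists_coarsening hp0 hV hL (hω.monotoneOn_of_nonneg h0) hβ hn1 N hx hxL ha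
  obtain ⟨m, b, hm, hb, hmb, hmbt⟩ := hω.exists_affine_majorant h0 (div_pos hS hP0)
  -- the coarse sum, by the affine majorant and summation by parts
  have hMn : (M:ℝ) ≤ n := by exact_mod_cast hM
  have h3 : ∑ i ∈ Finset.range M, max ((a ∘ σ) (i + 1) - (a ∘ σ) i) 0 ≤ P := by
    refine (sum_posPart_le_of_pVariation hp hV.le (ha.comp_monotone hσ) (by simp [hσ0, a0])
      (by simp [hσM, aN])).trans ?_
    have h4 : ((M:ℝ) + 1) ^ (1 - 1 / p) ≤ 2 * y ^ (1 - 1 / p) := by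
      calc ((M:ℝ) + 1) ^ (1 - 1 / p) ≤ (2 * y) ^ (1 - 1 / p) := by
            gcongr
            linarith
        _ = 2 ^ (1 - 1 / p) * y ^ (1 - 1 / p) := Real.mul_rpow (by norm_num) hy0.le
        _ ≤ 2 ^ (1:ℝ) * y ^ (1 - 1 / p) := by
            gcongr
            norm_num
        _ = _ := by norm_num
    rw [hP]
    nlinarith
  have h4 : cellSum (a ∘ σ) (fun i => (β ∘ x ∘ ρ) i - m * (x ∘ ρ) i) M ≤ b * P := by
    refine (cellSum_le_mul_sum_posPart (fun i => hapos _) (by simp [hσ0, a0])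
      (fun i j hij => ?_) M).trans (mul_le_mul_of_nonneg_left h3 hb)
    have h5 := hx (hρ hij)
    have := hβ _ _ h5
    have := hmb _ (sub_nonneg.2 h5)
    simp only [Function.comp_apply]
    linarith
  rw [cellSum_sub_const_mul] at h4
  have h5 : m * cellSum (a ∘ σ) (x ∘ ρ) M ≤ m * S :=
    mul_le_mul_of_nonneg_left (h2.trans haS) hm
  have h6 : P * ω (S / P) = m * S + b * P := by
    rw [← hmbt]; field_simp
  -- the loss in coarsening
  have h7 : ∑ m ∈ Finset.Ico n N, V * (2 / (m:ℝ)) ^ (1 / p) * ω (4 * L / m) ≤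
      V * (256 * p * C * (L ^ (1 - 1 / (2 * p)) * y ^ (-(1 / (2 * p))))) := by
    have h8 := sum_coarsening_loss_le hp hω h0 hC hC0 hL hn1 (by linarith) N
    have h9 : (n:ℝ) ^ (-(1 / (2 * p))) ≤ 2 * y ^ (-(1 / (2 * p))) := by
      calc (n:ℝ) ^ (-(1 / (2 * p))) ≤ (y / 2) ^ (-(1 / (2 * p))) :=
            Real.rpow_le_rpow_of_nonpos (by positivity) (by linarith)
              (by linarith [show 0 < 1 / (2 * p) by positivity])
        _ = 2 ^ (1 / (2 * p)) * y ^ (-(1 / (2 * p))) := by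
            rw [Real.div_rpow hy0.le (by norm_num), Real.rpow_neg (by norm_num : (0:ℝ) ≤ 2)]
            field_simp
        _ ≤ 2 ^ (1:ℝ) * y ^ (-(1 / (2 * p))) := by
            gcongr
            norm_num
        _ = _ := by norm_num
    calc _ = V * ∑ m ∈ Finset.Ico n N, (2 / (m:ℝ)) ^ (1 / p) * ω (4 * L / m) := by
          rw [Finset.mul_sum]
          exact Finset.sum_congr rfl fun i _ => by ring
      _ ≤ V * (128 * p * C * (L ^ (1 - 1 / (2 * p)) * (2 * y ^ (-(1 / (2 * p)))))) := by
          gcongr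
          exact h8.trans (by gcongr)
      _ = _ := by ring
  linarith

/-- The bound of the theorem for sums over cells. The number of coarse cells is `L / h ^ (2 p)` for
`h ≤ 1`; then the main term of `cellSum_le_of_coarsening` is the first term of `starModulus`, and
its error term is linear in `h`. For `h > 1`, coarse cells of length one suffice. -/
theorem cellSum_le_starModulus {p : ℝ} (hp : 1 ≤ p) {ω : ℝ → ℝ} (hω : ConcaveOn ℝ (Ici 0) ω)
    (h0 : ∀ h ≥ 0, 0 ≤ ω h) {C : ℝ} (hC : ∀ h ∈ Ioo (0 : ℝ) 1, ω h ≤ C * h ^ (1 - 1 / (2 * p)))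
    (hC0 : 0 ≤ C) {β : ℝ → ℝ} (hβ : ∀ x y, y ≤ x → β x - β y ≤ ω (x - y))
    {V L h : ℝ} (hV : 0 < V) (hL : 0 < L) (hh : 0 < h) (hhL : h ^ p ≤ L)
    {N : ℕ} {a x : ℕ → ℝ} (hx : Monotone x) (hxL : x N - x 0 ≤ L) (ha : HasPVariationLE p V a)
    (hapos : ∀ i, 0 ≤ a i) (a0 : a 0 = 0) (aN : a (N + 1) = 0)
    (haS : cellSum a x N ≤ V * L ^ (1 - 1 / p) * h) :
    cellSum a (β ∘ x) N ≤ V * L ^ (1 - 1 / p) * starModulus ω p ((256 * p + 2) * C) h := by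
  have hp0 : 0 < p := by linarith
  have hLp : 0 < L ^ (1 - 1 / p) := by positivity
  have hS : 0 < V * L ^ (1 - 1 / p) * h := by positivity
  have eL : L ^ (1 - 1 / (2 * p)) * L ^ (-(1 / (2 * p))) = L ^ (1 - 1 / p) := by
    rw [← Real.rpow_add hL]
    congr 1
    field_simp
    ring
  rcases le_or_gt h 1 with h1 | h1
  · have hℓ : 0 < h ^ (2 * p) := by positivity
    have hℓ1 : h ^ (2 * p) ≤ 1 := Real.rpow_le_one hh.le h1 (by positivity)
    have hℓL : h ^ (2 * p) ≤ L :=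
      (Real.rpow_le_rpow_of_exponent_ge hh h1 (by linarith)).trans hhL
    have key := cellSum_le_of_coarsening hp hω h0 hC hC0 hβ hV hL hS
      (y := L / h ^ (2 * p)) (by rwa [le_div_iff₀ hℓ, one_mul])
      (by rw [le_div_iff₀ hℓ]; nlinarith) hx hxL ha hapos a0 aN haS
    have e1 : (L / h ^ (2 * p)) ^ (1 - 1 / p) = L ^ (1 - 1 / p) * h ^ (2 - 2 * p) := by
      rw [Real.div_rpow hL.le hℓ.le, ← Real.rpow_mul hh.le, div_eq_mul_inv, ← Real.rpow_neg hh.le]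
      congr 2
      field_simp
      ring
    have e2 : V * L ^ (1 - 1 / p) * h / (V * (L ^ (1 - 1 / p) * h ^ (2 - 2 * p)))
        = h ^ (2 * p - 1) := by
      have : h ^ (2 * p - 1) * h ^ (2 - 2 * p) = h := by
        rw [← Real.rpow_add hh]; ring_nf; exact Real.rpow_one h
      rw [div_eq_iff (by positivity)]
      nth_rewrite 1 [← this]
      ring
    have e3 : L ^ (1 - 1 / (2 * p)) * (L / h ^ (2 * p)) ^ (-(1 / (2 * p)))
        = L ^ (1 - 1 / p) * h := by
      rw [Real.div_rpow hL.le hℓ.le, ← Real.rpow_mul hh.le,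
        show 2 * p * -(1 / (2 * p)) = -1 by field_simp, Real.rpow_neg_one, div_inv_eq_mul,
        ← mul_assoc, eL]
    rw [e1, e2, e3] at key
    refine key.trans ?_
    unfold starModulus
    have : 0 ≤ V * L ^ (1 - 1 / p) * (2 * C * h) := by positivity
    nlinarith
  · have hL1 : 1 ≤ L := (Real.one_le_rpow h1.le hp0.le).trans hhL
    have key := cellSum_le_of_coarsening hp hω h0 hC hC0 hβ hV hL hS hL1 le_rfl hx hxL ha
      hapos a0 aN haS
    rw [eL, mul_div_cancel_left₀ _ (by positivity)] at key
    have h2 : ω h ≤ 2 * C * h := by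
      have i1 := hω.apply_mul_le_mul_apply h0 (show 1 ≤ 2 * h by linarith)
        (show (0:ℝ) ≤ 1 / 2 by norm_num)
      have i2 := hC (1 / 2) (by constructor <;> norm_num)
      have i3 : C * (1 / 2 : ℝ) ^ (1 - 1 / (2 * p)) ≤ C * 1 := by
        gcongr
        refine Real.rpow_le_one (by norm_num) (by norm_num) ?_
        rw [sub_nonneg, div_le_one (by positivity)]
        linarith
      rw [show 2 * h * (1 / 2) = h by ring] at i1
      nlinarith
    have h3 : 0 ≤ h ^ (2 - 2 * p) * ω (h ^ (2 * p - 1)) :=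
      mul_nonneg (by positivity) (h0 _ (by positivity))
    calc cellSum a (β ∘ x) N ≤ _ := key
      _ = V * L ^ (1 - 1 / p) * (ω h + 256 * p * C * 1) := by ring
      _ ≤ V * L ^ (1 - 1 / p) * (2 * C * h + 256 * p * C * h) := by gcongr
      _ ≤ _ := by
          unfold starModulus
          refine mul_le_mul_of_nonneg_left ?_ (by positivity)
          linarith

/-! ### Approximation by step functions -/

/-- Repetitions in a weakly monotone sequence can be removed without changing the variation. -/
theorem exists_strictMono_sum_eq {p : ℝ} (hp : 0 < p) (f : ℝ → ℝ) {u : ℕ → ℝ} (hu : Monotone u)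
    (n : ℕ) : ∃ (N : ℕ) (x : Fin (N + 1) → ℝ), StrictMono x ∧ x (Fin.last N) = u n ∧
      ∑ i : Fin N, |f (x i.succ) - f (x i.castSucc)| ^ p =
        ∑ i ∈ Finset.range n, |f (u (i + 1)) - f (u i)| ^ p := by
  induction n with
  | zero => exact ⟨0, fun _ => u 0, fun i j h => by omega, rfl, by simp⟩
  | succ n ih =>
    obtain ⟨N, x, hx, hlast, hsum⟩ := ih
    rcases (hu (Nat.le_succ n)).eq_or_lt with h | h
    · refine ⟨N, x, hx, hlast.trans h, ?_⟩
      rw [Finset.sum_range_succ, ← hsum, ← h]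
      simp [Real.zero_rpow hp.ne']
    · refine ⟨N + 1, Fin.snoc x (u (n + 1)), ?_, by simp, ?_⟩
      · rw [Fin.strictMono_iff_lt_succ]
        intro i
        refine Fin.lastCases ?_ (fun j => ?_) i
        · rw [Fin.succ_last, Fin.snoc_last, Fin.snoc_castSucc, hlast]
          exact h
        · rw [Fin.succ_castSucc, Fin.snoc_castSucc, Fin.snoc_castSucc]
          exact hx Fin.castSucc_lt_succ
      · rw [Finset.sum_range_succ, ← hsum, Fin.sum_univ_castSucc]
        congr 1
        · refine Finset.sum_congr rfl fun j _ => ?_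
          rw [Fin.succ_castSucc, Fin.snoc_castSucc, Fin.snoc_castSucc]
        · rw [Fin.succ_last, Fin.snoc_last, Fin.snoc_castSucc, hlast]

theorem hasPVariationLE_pVariationOn {p : ℝ} (hp : 1 ≤ p) {f : ℝ → ℝ}
    (hf : ePVariationOn p f univ ≠ ∞) : HasPVariationLE p (pVariationOn p f univ) f := by
  intro n u hu
  have hp0 : 0 < p := by linarith
  obtain ⟨N, x, hx, -, hsum⟩ := exists_strictMono_sum_eq hp0 f hu n
  have h1 : ENNReal.ofReal ((∑ i : Fin N, |f (x i.succ) - f (x i.castSucc)| ^ p) ^ (1 / p))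
      ≤ ePVariationOn p f univ :=
    le_iSup_of_le N (le_iSup_of_le x (le_iSup_of_le ⟨hx, fun _ => mem_univ _⟩ le_rfl))
  have h2 := (ENNReal.ofReal_le_iff_le_toReal hf).1 h1
  rw [← hsum]
  rwa [one_div, Real.rpow_inv_le_iff_of_pos (Finset.sum_nonneg fun i _ => by positivity)
    ENNReal.toReal_nonneg hp0] at h2

/-- The `p`-th power of the `p`-variation of `f` on `(-∞, x]`, as a function of `x`. -/
noncomputable def leftPVariation (p : ℝ) (f : ℝ → ℝ) (x : ℝ) : ℝ :=
  sSup {s | ∃ (n : ℕ) (u : ℕ → ℝ), Monotone u ∧ u n ≤ x ∧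
    s = ∑ i ∈ Finset.range n, |f (u (i + 1)) - f (u i)| ^ p}

theorem leftPVariation_nonneg (p : ℝ) (f : ℝ → ℝ) (x : ℝ) : 0 ≤ leftPVariation p f x := by
  refine Real.sSup_nonneg ?_
  rintro s ⟨n, u, -, -, rfl⟩
  exact Finset.sum_nonneg fun i _ => by positivity

namespace HasPVariationLE

variable {p V : ℝ} {f : ℝ → ℝ}

theorem leftPVariation_le (hf : HasPVariationLE p V f) (x : ℝ) :
    leftPVariation p f x ≤ V ^ p := by
  refine csSup_le ⟨0, 0, fun _ => x, monotone_const, le_rfl, by simp⟩ ?_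
  rintro s ⟨n, u, hu, -, rfl⟩
  exact hf n u hu

theorem leftPVariation_add_le (hf : HasPVariationLE p V f) {x y : ℝ} (hxy : x ≤ y) :
    leftPVariation p f x + |f y - f x| ^ p ≤ leftPVariation p f y := by
  have hbdd : BddAbove {s | ∃ (n : ℕ) (u : ℕ → ℝ), Monotone u ∧ u n ≤ y ∧
      s = ∑ i ∈ Finset.range n, |f (u (i + 1)) - f (u i)| ^ p} := by
    refine ⟨V ^ p, ?_⟩
    rintro s ⟨n, u, hu, -, rfl⟩
    exact hf n u hu
  rw [← le_sub_iff_add_le]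
  refine csSup_le ⟨0, 0, fun _ => x, monotone_const, le_rfl, by simp⟩ ?_
  rintro s ⟨n, u, hu, hux, rfl⟩
  rw [le_sub_iff_add_le]
  -- append the points `x` and `y` to the sequence
  set v : ℕ → ℝ := fun i => if i ≤ n then u i else if i = n + 1 then x else y with hv
  have hvm : Monotone v := by
    refine monotone_nat_of_le_succ fun i => ?_
    simp only [hv]
    have := hu (show i ≤ i + 1 by omega)
    rcases lt_trichotomy i n with h | rfl | h
    · rwa [if_pos h.le, if_pos (show i + 1 ≤ n by omega)]
    · rwa [if_pos le_rfl, if_neg (show ¬i + 1 ≤ i by omega), if_pos rfl]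
    · rw [if_neg (show ¬i ≤ n by omega), if_neg (show ¬i + 1 ≤ n by omega),
        if_neg (show ¬i + 1 = n + 1 by omega)]
      split_ifs
      · exact hxy
      · exact le_rfl
  have h1 : ∑ i ∈ Finset.range (n + 2), |f (v (i + 1)) - f (v i)| ^ p
      ≤ leftPVariation p f y := by
    refine le_csSup hbdd ⟨n + 2, v, hvm, ?_, rfl⟩
    simp [hv]
  rw [Finset.sum_range_succ, Finset.sum_range_succ] at h1
  have h2 : ∑ i ∈ Finset.range n, |f (v (i + 1)) - f (v i)| ^ p =
      ∑ i ∈ Finset.range n, |f (u (i + 1)) - f (u i)| ^ p := by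
    refine Finset.sum_congr rfl fun i hi => ?_
    have := Finset.mem_range.1 hi
    have e1 : v (i + 1) = u (i + 1) := by simp only [hv]; rw [if_pos (by omega)]
    have e2 : v i = u i := by simp only [hv]; rw [if_pos (by omega)]
    rw [e1, e2]
  have e3 : v (n + 1) = x := by simp [hv]
  have e4 : v (n + 1 + 1) = y := by simp [hv]
  rw [h2, e3, e4] at h1
  have : 0 ≤ |f x - f (v n)| ^ p := by positivity
  linarith

/-- A function of bounded `p`-variation is uniformly close to step functions: the line splits into
finitely many consecutive intervals, numbered by `N`, on each of which `f` oscillates little. -/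
theorem exists_monotone_nat (hf : HasPVariationLE p V f) (hp : 0 < p) {η : ℝ} (hη : 0 < η) :
    ∃ (N : ℝ → ℕ) (Q : ℕ), Monotone N ∧ (∀ x, N x ≤ Q) ∧
      ∀ x y, N x = N y → |f x - f y| ≤ η := by
  have hηp : 0 < η ^ p := by positivity
  have hmono : Monotone (leftPVariation p f) := fun x y hxy => by
    have := hf.leftPVariation_add_le hxy
    have : 0 ≤ |f y - f x| ^ p := by positivity
    linarith
  have key : ∀ x y, x ≤ y → ⌊leftPVariation p f x / η ^ p⌋₊ = ⌊leftPVariation p f y / η ^ p⌋₊ →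
      |f y - f x| ≤ η := by
    intro x y hxy hN
    have h1 := Nat.floor_le (div_nonneg (leftPVariation_nonneg p f x) hηp.le)
    have h2 := Nat.lt_floor_add_one (leftPVariation p f y / η ^ p)
    rw [← hN] at h2
    have h3 : leftPVariation p f y / η ^ p - leftPVariation p f x / η ^ p < 1 := by linarith
    rw [← sub_div, div_lt_one hηp] at h3
    have h4 := hf.leftPVariation_add_le hxy
    exact (Real.rpow_le_rpow_iff (abs_nonneg _) hη.le hp).1 (by linarith)
  refine ⟨fun x => ⌊leftPVariation p f x / η ^ p⌋₊, ⌊V ^ p / η ^ p⌋₊, ?_, ?_, ?_⟩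
  · intro x y hxy
    exact Nat.floor_le_floor (by gcongr; exact hmono hxy)
  · intro x
    exact Nat.floor_le_floor (by gcongr; exact hf.leftPVariation_le x)
  · intro x y hN
    rcases le_total x y with h | h
    · rw [abs_sub_comm]
      exact key x y h hN
    · exact key y x h hN.symm

/-- The step functions of `exists_monotone_nat` can be chosen as `f ∘ τ` with `τ` monotone, so
that their `p`-variation is no larger than that of `f`. -/
theorem exists_step_approx (hf : HasPVariationLE p V f) (hp : 0 < p) {η : ℝ} (hη : 0 < η) :
    ∃ (N : ℝ → ℕ) (Q : ℕ) (r : ℕ → ℝ), Monotone N ∧ (∀ x, N x ≤ Q) ∧ Monotone (r ∘ N) ∧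
      ∀ x, |f x - f (r (N x))| ≤ η := by
  obtain ⟨N, Q, hN, hQ, hosc⟩ := hf.exists_monotone_nat hp hη
  have hr : ∀ x, N (Function.invFun N (N x)) = N x := fun x => Function.invFun_eq ⟨x, rfl⟩
  refine ⟨N, Q, Function.invFun N, hN, hQ, ?_, fun x => hosc _ _ (hr x).symm⟩
  intro x y hxy
  rcases (hN hxy).eq_or_lt with h | h
  · simp [h]
  · by_contra! hlt
    have := hN hlt.le
    simp only [Function.comp_apply, hr] at this
    omega

theorem measurable (hf : HasPVariationLE p V f) (hp : 0 < p) : Measurable f := by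
  have hε : ∀ n : ℕ, (0:ℝ) < 1 / (n + 1) := fun n => Nat.one_div_pos_of_nat
  choose N Q r hN _ _ hη using fun n : ℕ => hf.exists_step_approx hp (hε n)
  refine measurable_of_tendsto_metrizable (f := fun n x => f (r n (N n x))) (fun n => ?_) ?_
  · exact (measurable_from_top (f := fun k => f (r n k))).comp (hN n).measurable
  · rw [tendsto_pi_nhds]
    intro x
    rw [tendsto_iff_dist_tendsto_zero]
    refine squeeze_zero (fun n => dist_nonneg) (fun n => ?_)
      (tendsto_one_div_add_atTop_nhds_zero_nat (𝕜 := ℝ))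
    rw [dist_comm, Real.dist_eq]
    exact hη n x

end HasPVariationLE

/-! ### Riemann–Stieltjes sums and integrals -/

/-- A tagged partition, extended to monotone sequences that stay in the interval. -/
theorem exists_nat_extension {A : Set ℝ} {N : ℕ} {x : Fin (N + 1) → ℝ} {y : Fin N → ℝ}
    (hx : IsTuplePartition A x) (hy : IsTuplePartition A y)
    (hxy : ∀ i : Fin N, y i ∈ Icc (x i.castSucc) (x i.succ)) :
    ∃ X Y : ℕ → ℝ, Monotone X ∧ Monotone Y ∧ (∀ i, X i ∈ A) ∧ (∀ i, Y i ∈ A) ∧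
      (∀ i < N, X i ≤ Y i ∧ Y i ≤ X (i + 1)) ∧ X 0 = x 0 ∧ X N = x (Fin.last N) ∧
      (∀ f g : ℝ → ℝ, rsSum f g x y =
        ∑ i ∈ Finset.range N, f (Y i) * (g (X (i + 1)) - g (X i))) ∧
      ∀ i < N, X (i + 1) - X i ≤ partitionResolution A x := by
  set X : ℕ → ℝ := fun i => x ⟨min i N, by omega⟩ with hX
  set Y : ℕ → ℝ := fun i => if h : i < N then y ⟨i, h⟩ else x (Fin.last N) with hY
  have X1 : ∀ i : Fin N, X i = x i.castSucc := fun i => by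
    simp only [hX]
    congr 1
    ext
    simp only [Fin.val_castSucc]
    omega
  have X2 : ∀ i : Fin N, X (i + 1) = x i.succ := fun i => by
    simp only [hX]
    congr 1
    ext
    simp only [Fin.val_succ]
    omega
  have Y1 : ∀ i : Fin N, Y i = y i := fun i => by simp [hY]
  refine ⟨X, Y, ?_, ?_, fun i => hx.2 _, ?_, ?_, ?_, ?_, ?_, ?_⟩
  · intro i j hij
    refine hx.1.monotone ?_
    simp only [Fin.mk_le_mk]
    omega
  · intro i j hij
    by_cases hj : j < N
    · have hi : i < N := by omega
      simp only [hY, hi, hj, dif_pos]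
      exact hy.1.monotone (by simpa using hij)
    · by_cases hi : i < N
      · simp only [hY, hi, hj, dif_pos, dif_neg, not_false_eq_true]
        exact (hxy ⟨i, hi⟩).2.trans (hx.1.monotone (Fin.le_last _))
      · simp [hY, hi, hj]
  · intro i
    simp only [hY]
    split_ifs
    · exact hy.2 _
    · exact hx.2 _
  · intro i hi
    have := hxy ⟨i, hi⟩
    rw [← X1, ← X2, ← Y1] at this
    exact this
  · simp [hX]
  · simp [hX, Fin.last]
  · intro f g
    rw [rsSum, Finset.sum_range]
    refine Finset.sum_congr rfl fun i _ => ?_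
    rw [X1, X2, Y1]
  · intro i hi
    have h := le_ciSup (f := fun i : Fin N => x i.succ - x i.castSucc)
      (Set.finite_range _).bddAbove ⟨i, hi⟩
    rw [← X1, ← X2] at h
    exact h.trans ((le_max_left _ _).trans (le_max_right _ _))

/-- A number `N` of cells, `N + 1` division points and `N` tags, not yet subject to any order. -/
abbrev TupleTagged : Type := Σ N : ℕ, (Fin (N + 1) → ℝ) × (Fin N → ℝ)

/-- The tagged partitions of `A` of resolution less than `δ`. -/
def taggedFiner (A : Set ℝ) (δ : ℝ) : Set TupleTagged :=
  {P | IsTuplePartition A P.2.1 ∧ IsTuplePartition A P.2.2 ∧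
    (∀ i : Fin P.1, P.2.2 i ∈ Icc (P.2.1 i.castSucc) (P.2.1 i.succ)) ∧
    partitionResolution A P.2.1 < δ}

/-- The filter along which Riemann–Stieltjes sums converge: resolution tending to zero. -/
def rsFilter (A : Set ℝ) : Filter TupleTagged :=
  ⨅ δ ∈ Ioi (0 : ℝ), 𝓟 (taggedFiner A δ)

theorem rsFilter_hasBasis (A : Set ℝ) :
    (rsFilter A).HasBasis (fun δ : ℝ => δ ∈ Ioi (0 : ℝ)) (taggedFiner A) := by
  refine hasBasis_biInf_principal ?_ ⟨1, mem_Ioi.2 one_pos⟩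
  intro δ hδ δ' hδ'
  refine ⟨min δ δ', mem_Ioi.2 (lt_min (mem_Ioi.1 hδ) (mem_Ioi.1 hδ')), ?_, ?_⟩
  · rintro P ⟨h1, h2, h3, h4⟩
    exact ⟨h1, h2, h3, h4.trans_le (min_le_left _ _)⟩
  · rintro P ⟨h1, h2, h3, h4⟩
    exact ⟨h1, h2, h3, h4.trans_le (min_le_right _ _)⟩

theorem hasRSIntegralOn_iff_tendsto {f g : ℝ → ℝ} {A : Set ℝ} {I : ℝ} :
    HasRSIntegralOn f g A I ↔
      Tendsto (fun P : TupleTagged => rsSum f g P.2.1 P.2.2) (rsFilter A) (𝓝 I) := by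
  rw [(rsFilter_hasBasis A).tendsto_iff Metric.nhds_basis_ball]
  simp only [Metric.mem_ball, Real.dist_eq, mem_Ioi]
  constructor
  · intro h ε hε
    obtain ⟨δ, hδ, H⟩ := h ε hε
    exact ⟨δ, hδ, fun P hP => H P.1 P.2.1 P.2.2 hP.1 hP.2.1 hP.2.2.1 hP.2.2.2⟩
  · intro h ε hε
    obtain ⟨δ, hδ, H⟩ := h ε hε
    exact ⟨δ, hδ, fun N x y h1 h2 h3 h4 => H ⟨N, x, y⟩ ⟨h1, h2, h3, h4⟩⟩

theorem HasRSIntegralOn.add {f₁ f₂ g : ℝ → ℝ} {A : Set ℝ} {I₁ I₂ : ℝ}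
    (h₁ : HasRSIntegralOn f₁ g A I₁) (h₂ : HasRSIntegralOn f₂ g A I₂) :
    HasRSIntegralOn (fun x => f₁ x + f₂ x) g A (I₁ + I₂) := by
  rw [hasRSIntegralOn_iff_tendsto] at *
  refine (h₁.add h₂).congr fun P => ?_
  simp only [rsSum, ← Finset.sum_add_distrib]
  exact Finset.sum_congr rfl fun i _ => by ring

theorem HasRSIntegralOn.const_mul {f g : ℝ → ℝ} {A : Set ℝ} {I : ℝ}
    (h : HasRSIntegralOn f g A I) (c : ℝ) :
    HasRSIntegralOn (fun x => c * f x) g A (c * I) := by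
  rw [hasRSIntegralOn_iff_tendsto] at *
  refine (h.const_mul c).congr fun P => ?_
  simp only [rsSum, Finset.mul_sum]
  exact Finset.sum_congr rfl fun i _ => by ring

theorem exists_hasRSIntegralOn_sum {g : ℝ → ℝ} {A : Set ℝ} {f : ℕ → ℝ → ℝ} (Q : ℕ)
    (h : ∀ j, ∃ I, HasRSIntegralOn (f j) g A I) :
    ∃ I, HasRSIntegralOn (fun x => ∑ j ∈ Finset.range Q, f j x) g A I := by
  induction Q with
  | zero => exact ⟨0, fun ε hε => ⟨1, one_pos, fun N x y _ _ _ _ => by simpa [rsSum] using hε⟩⟩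
  | succ Q ih =>
    obtain ⟨I, hI⟩ := ih
    obtain ⟨I', hI'⟩ := h Q
    refine ⟨I + I', ?_⟩
    simp only [Finset.sum_range_succ]
    exact hI.add hI'

/-- If the Riemann–Stieltjes sums of `f` are uniformly close to those of integrable functions,
then `f` is integrable. -/
theorem exists_hasRSIntegralOn_of_approx {f g : ℝ → ℝ} {A : Set ℝ}
    (h : ∀ ε > 0, ∃ f' : ℝ → ℝ, (∃ I, HasRSIntegralOn f' g A I) ∧
      ∀ (N : ℕ) (x : Fin (N + 1) → ℝ) (y : Fin N → ℝ),
        IsTuplePartition A x → IsTuplePartition A y →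
        (∀ i : Fin N, y i ∈ Icc (x i.castSucc) (x i.succ)) →
        |rsSum f g x y - rsSum f' g x y| ≤ ε) :
    ∃ I, HasRSIntegralOn f g A I := by
  simp only [hasRSIntegralOn_iff_tendsto] at *
  rcases (rsFilter A).eq_or_neBot with hbot | hne
  · exact ⟨0, by rw [hbot]; exact tendsto_bot⟩
  refine (cauchy_map_iff_exists_tendsto (l := rsFilter A)).1 ?_
  rw [Metric.cauchy_iff]
  refine ⟨inferInstance, fun ε hε => ?_⟩
  obtain ⟨f', ⟨I, hI⟩, happ⟩ := h (ε / 4) (by positivity)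
  rw [(rsFilter_hasBasis A).tendsto_iff Metric.nhds_basis_ball] at hI
  obtain ⟨δ, hδ, H⟩ := hI (ε / 4) (by positivity)
  refine ⟨_, image_mem_map ((rsFilter_hasBasis A).mem_of_mem hδ), ?_⟩
  have key : ∀ P ∈ taggedFiner A δ, |rsSum f g P.2.1 P.2.2 - I| < ε / 2 := by
    intro P hP
    have h1 := happ P.1 P.2.1 P.2.2 hP.1 hP.2.1 hP.2.2.1
    have h2 := H P hP
    rw [Metric.mem_ball, Real.dist_eq] at h2
    have := abs_sub_le (rsSum f g P.2.1 P.2.2) (rsSum f' g P.2.1 P.2.2) I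
    linarith
  rintro _ ⟨P, hP, rfl⟩ _ ⟨P', hP', rfl⟩
  have h1 := key P hP
  have h2 := key P' hP'
  rw [abs_sub_comm] at h2
  rw [Real.dist_eq]
  have := abs_sub_le (rsSum f g P.2.1 P.2.2) I (rsSum f g P'.2.1 P'.2.2)
  linarith

/-- The indicator function of an upper set is integrable against a continuous function `β`. -/
theorem exists_hasRSIntegralOn_indicator {β : ℝ → ℝ} (hβ : Continuous β) {R : ℝ} (hR : 0 < R)
    {U : Set ℝ} (hU : IsUpperSet U) :
    ∃ I, HasRSIntegralOn (U.indicator 1) β (Ioo (-R) R) I := by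
  have hlt : -R < R := by linarith
  set E := (U ∩ Icc (-R) R) ∪ {R} with hE
  have hEne : E.Nonempty := ⟨R, Or.inr rfl⟩
  have hElb : ∀ w ∈ E, -R ≤ w := by
    rintro w (hw | rfl)
    · exact hw.2.1
    · exact hlt.le
  set c := sInf E with hc
  have hbdd : BddBelow E := ⟨-R, hElb⟩
  have hcR : c ≤ R := csInf_le hbdd (Or.inr rfl)
  have hRc : -R ≤ c := le_csInf hEne hElb
  have hcU : ∀ z ∈ Ioo (-R) R, z ∈ U → c ≤ z := fun z hz hzU =>
    csInf_le hbdd (Or.inl ⟨hzU, hz.1.le, hz.2.le⟩)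
  have hUc : ∀ z ∈ Ioo (-R) R, z ∉ U → z ≤ c := by
    intro z hz hzU
    refine le_csInf hEne ?_
    rintro w (hw | rfl)
    · by_contra! hlt
      exact hzU (hU hlt.le hw.1)
    · exact hz.2.le
  refine ⟨β R - β c, fun ε hε => ?_⟩
  have huc := (isCompact_Icc (a := -R) (b := R)).uniformContinuousOn_of_continuous
    hβ.continuousOn
  rw [Metric.uniformContinuousOn_iff] at huc
  obtain ⟨δ, hδ, H⟩ := huc (ε / 2) (by positivity)
  refine ⟨δ / 2, by positivity, fun N x y hx hy hxy hres => ?_⟩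
  obtain ⟨X, Y, hX, hY, hXA, hYA, hXY, hX0, hXN, hsum, hmesh⟩ := exists_nat_extension hx hy hxy
  have hend0 : X 0 - -R < δ / 2 := by
    have := (le_max_left _ _).trans_lt hres
    rwa [csInf_Ioo hlt, ← hX0] at this
  have hendN : R - X N < δ / 2 := by
    have := ((le_max_right _ _).trans (le_max_right _ _)).trans_lt hres
    rwa [csSup_Ioo hlt, ← hXN] at this
  -- the tags from the `k`-th on are those that belong to `U`
  obtain ⟨k, hkN, hk⟩ : ∃ k ≤ N, ∀ i < N, (Y i ∈ U ↔ k ≤ i) := by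
    classical
    have hex : ∃ k, k = N ∨ Y k ∈ U := ⟨N, Or.inl rfl⟩
    refine ⟨Nat.find hex, Nat.find_min' hex (Or.inl rfl), fun i hi => ⟨fun h =>
      Nat.find_min' hex (Or.inr h), fun h => ?_⟩⟩
    rcases Nat.find_spec hex with h' | h'
    · omega
    · exact hU (hY h) h'
  have hval : rsSum (U.indicator 1) β x y = β (X N) - β (X k) := by
    rw [hsum, ← Finset.sum_range_add_sum_Ico _ hkN, Finset.sum_eq_zero, zero_add]
    · rw [← Finset.sum_Ico_sub (fun i => β (X i)) hkN]
      refine Finset.sum_congr rfl fun i hi => ?_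
      rw [indicator_of_mem ((hk i (Finset.mem_Ico.1 hi).2).2 (Finset.mem_Ico.1 hi).1)]
      simp
    · intro i hi
      have hi' := Finset.mem_range.1 hi
      rw [indicator_of_notMem (fun h => by have := (hk i (by omega)).1 h; omega), zero_mul]
  have hlow : X k - c < δ := by
    rcases Nat.eq_zero_or_pos k with h0 | h0
    · rw [h0]; linarith
    · have h1 : Y (k - 1) ∉ U := fun h => by
        have := (hk (k - 1) (by omega)).1 h; omega
      have h2 := hUc _ (hYA _) h1
      have h3 := (hXY (k - 1) (by omega)).1
      have h4 := hmesh (k - 1) (by omega)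
      rw [show k - 1 + 1 = k by omega] at h4
      linarith
  have hupp : c - X k < δ := by
    rcases hkN.eq_or_lt with h0 | h0
    · rw [h0]; linarith
    · have h2 := hcU _ (hYA k) ((hk k h0).2 le_rfl)
      have h3 := (hXY k h0).2
      have h4 := hmesh k h0
      linarith
  have h1 := H (X N) ⟨(hXA N).1.le, (hXA N).2.le⟩ R ⟨hlt.le, le_rfl⟩ (by
    rw [Real.dist_eq, abs_lt]
    constructor <;> linarith [(hXA N).2])
  have h2 := H (X k) ⟨(hXA k).1.le, (hXA k).2.le⟩ c ⟨hRc, hcR⟩ (by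
    rw [Real.dist_eq, abs_lt]
    constructor <;> linarith)
  rw [Real.dist_eq, abs_lt] at h1 h2
  rw [hval, abs_lt]
  constructor <;> linarith [h1.1, h1.2, h2.1, h2.2]

theorem exists_hasRSIntegralOn_step {β : ℝ → ℝ} (hβ : Continuous β) {R : ℝ} (hR : 0 < R)
    {N : ℝ → ℕ} {Q : ℕ} (hN : Monotone N) (hQ : ∀ x, N x ≤ Q) (G : ℕ → ℝ) :
    ∃ I, HasRSIntegralOn (fun x => G (N x)) β (Ioo (-R) R) I := by
  have e : (fun x => G (N x)) = fun x => G 0 * (univ : Set ℝ).indicator (1 : ℝ → ℝ) x +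
      ∑ j ∈ Finset.range Q, (G (j + 1) - G j) * {x | j < N x}.indicator (1 : ℝ → ℝ) x := by
    funext x
    rw [← Finset.sum_range_add_sum_Ico _ (hQ x)]
    have h1 : ∑ j ∈ Finset.range (N x), (G (j + 1) - G j) *
        {x | j < N x}.indicator (1 : ℝ → ℝ) x = G (N x) - G 0 := by
      rw [← Finset.sum_range_sub]
      refine Finset.sum_congr rfl fun j hj => ?_
      rw [indicator_of_mem (by simpa using hj)]
      simp
    have h2 : ∑ j ∈ Finset.Ico (N x) Q, (G (j + 1) - G j) *
        {x | j < N x}.indicator (1 : ℝ → ℝ) x = 0 := by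
      refine Finset.sum_eq_zero fun j hj => ?_
      rw [indicator_of_notMem (by simpa using (Finset.mem_Ico.1 hj).1), mul_zero]
    rw [h1, h2]
    simp
  rw [e]
  obtain ⟨I, hI⟩ := exists_hasRSIntegralOn_indicator hβ hR isUpperSet_univ
  obtain ⟨I', hI'⟩ := exists_hasRSIntegralOn_sum (g := β) (A := Ioo (-R) R) Q
    (f := fun j x => (G (j + 1) - G j) * {x | j < N x}.indicator (1 : ℝ → ℝ) x) (fun j => by
      obtain ⟨I, hI⟩ := exists_hasRSIntegralOn_indicator hβ hR (U := {x | j < N x})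
        (fun x y hxy hx => lt_of_lt_of_le hx (hN hxy))
      exact ⟨_, hI.const_mul _⟩)
  exact ⟨_, (hI.const_mul _).add hI'⟩

/-- All Riemann–Stieltjes sums on `(-R, R)` are controlled by the variation and the supremum
norm. Bounds from above suffice for this: they are applied to `η + f` and to `η - f`. -/
theorem exists_abs_rsSum_le {p : ℝ} (hp : 1 ≤ p) {ω : ℝ → ℝ} (hω : ConcaveOn ℝ (Ici 0) ω)
    (h0 : ∀ h ≥ 0, 0 ≤ ω h) {C : ℝ} (hC : ∀ h ∈ Ioo (0 : ℝ) 1, ω h ≤ C * h ^ (1 - 1 / (2 * p)))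
    (hC0 : 0 ≤ C) {β : ℝ → ℝ} (hβc : Continuous β) (hβ : ∀ x y, y ≤ x → β x - β y ≤ ω (x - y))
    {R : ℝ} (hR : 0 < R) :
    ∃ K : ℝ, 0 ≤ K ∧ ∀ (f : ℝ → ℝ) (V η : ℝ), 0 < V → HasPVariationLE p V f →
      (∀ x, |f x| ≤ η) → ∀ (N : ℕ) (x : Fin (N + 1) → ℝ) (y : Fin N → ℝ),
        IsTuplePartition (Ioo (-R) R) x → IsTuplePartition (Ioo (-R) R) y →
        (∀ i : Fin N, y i ∈ Icc (x i.castSucc) (x i.succ)) →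
        |rsSum f β x y| ≤ K * (V + η) := by
  obtain ⟨K, hK, HK⟩ := exists_cellSum_le_linear hp hω h0 hC hC0 hβ
    (show 0 < 2 * R by positivity)
  obtain ⟨B, hB⟩ := (isCompact_Icc (a := -R) (b := R)).exists_bound_of_continuousOn
    hβc.continuousOn
  have hB0 : 0 ≤ B := (norm_nonneg _).trans (hB 0 ⟨by linarith, hR.le⟩)
  have half : ∀ (f : ℝ → ℝ) (V η : ℝ), 0 < V → HasPVariationLE p V f →
      (∀ x, |f x| ≤ η) → ∀ (N : ℕ) (x : Fin (N + 1) → ℝ) (y : Fin N → ℝ),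
        IsTuplePartition (Ioo (-R) R) x → IsTuplePartition (Ioo (-R) R) y →
        (∀ i : Fin N, y i ∈ Icc (x i.castSucc) (x i.succ)) →
        rsSum f β x y ≤ (2 * K + 2 * B) * (V + η) := by
    intro f V η hV hf hη N x y hx hy hxy
    obtain ⟨X, Y, hX, hY, hXA, hYA, -, -, -, hsum, -⟩ := exists_nat_extension hx hy hxy
    have hη0 : 0 ≤ η := (abs_nonneg _).trans (hη 0)
    have h1 := HK N (fun i => f (Y (i - 1)) + η) X V (2 * η) hV hX
      (by linarith [(hXA N).2, (hXA 0).1])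
      ((hf.comp_monotone (hY.comp fun i j h => Nat.sub_le_sub_right h 1)).add_const η)
      (fun i => by linarith [(abs_le.1 (hη (Y (i - 1)))).1])
      (fun i => by linarith [(abs_le.1 (hη (Y (i - 1)))).2])
    have h2 : cellSum (fun i => f (Y (i - 1)) + η) (β ∘ X) N =
        rsSum f β x y + η * (β (X N) - β (X 0)) := by
      rw [hsum, ← Finset.sum_range_sub (fun i => β (X i)), cellSum, Finset.mul_sum,
        ← Finset.sum_add_distrib]
      refine Finset.sum_congr rfl fun i _ => ?_
      simp only [Function.comp_apply, Nat.add_sub_cancel]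
      ring
    rw [h2] at h1
    have h3 := hB (X N) ⟨(hXA N).1.le, (hXA N).2.le⟩
    have h4 := hB (X 0) ⟨(hXA 0).1.le, (hXA 0).2.le⟩
    rw [Real.norm_eq_abs, abs_le] at h3 h4
    have h5 : η * (-(2 * B)) ≤ η * (β (X N) - β (X 0)) :=
      mul_le_mul_of_nonneg_left (by linarith) hη0
    have h6 : 0 ≤ K * V := by positivity
    have h7 : 0 ≤ B * V := by positivity
    nlinarith
  refine ⟨2 * K + 2 * B, by positivity, ?_⟩
  intro f V η hV hf hη N x y hx hy hxy
  rw [abs_le]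
  refine ⟨?_, half f V η hV hf hη N x y hx hy hxy⟩
  have h1 := half (fun x => -f x) V η hV hf.neg (fun x => by rw [abs_neg]; exact hη x) N x y
    hx hy hxy
  have h2 : rsSum (fun x => -f x) β x y = -rsSum f β x y := by
    simp [rsSum, Finset.sum_neg_distrib]
  linarith

/-- Existence of the integral. The difference of `γ` and a step function close to it is small in
`2p`-variation by interpolation, so that the Hölder exponent belonging to `2p` is used. -/
theorem exists_hasRSIntegralOn {p : ℝ} (hp : 1 ≤ p) {ω : ℝ → ℝ} (hω : ConcaveOn ℝ (Ici 0) ω)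
    (h0 : ∀ h ≥ 0, 0 ≤ ω h) (hH : IsHolderAllOrdersLTOne ω) {β : ℝ → ℝ} (hβc : Continuous β)
    (hβ : ∀ x y, y ≤ x → β x - β y ≤ ω (x - y)) {γ : ℝ → ℝ} {V : ℝ} (hV : 0 ≤ V)
    (hγ : HasPVariationLE p V γ) {R : ℝ} (hR : 0 < R) :
    ∃ I, HasRSIntegralOn γ β (Ioo (-R) R) I := by
  have hp0 : 0 < p := by linarith
  have hq : 1 ≤ 2 * p := by linarith
  obtain ⟨C, hC⟩ := hH (1 - 1 / (2 * (2 * p))) ⟨by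
    rw [sub_pos, div_lt_one (by positivity)]; linarith, by
    linarith [show 0 < 1 / (2 * (2 * p)) by positivity]⟩
  have hC' : ∀ h ∈ Ioo (0 : ℝ) 1, ω h ≤ C * h ^ (1 - 1 / (2 * (2 * p))) := fun h hh => by
    have := hC ⟨h, hh, rfl⟩
    rwa [div_le_iff₀ (Real.rpow_pos_of_pos hh.1 _)] at this
  have hC0 : 0 ≤ C := by
    refine le_trans ?_ (hC ⟨1 / 2, by norm_num, rfl⟩)
    exact div_nonneg (h0 _ (by norm_num)) (by positivity)
  obtain ⟨K, hK, HK⟩ := exists_abs_rsSum_le hq hω h0 hC' hC0 hβc hβ hR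
  refine exists_hasRSIntegralOn_of_approx fun ε hε => ?_
  have hγ1 : HasPVariationLE p (V + 1) γ := hγ.mono hp0.le hV (by linarith)
  obtain ⟨η, hη, hsmall⟩ : ∃ η : ℝ, 0 < η ∧
      K * (Real.sqrt (2 * η * (2 * (V + 1))) + η) < ε := by
    have hcont : Continuous fun η : ℝ => K * (Real.sqrt (2 * η * (2 * (V + 1))) + η) := by
      fun_prop
    have h1 := hcont.tendsto 0
    simp only [mul_zero, zero_mul, Real.sqrt_zero, add_zero] at h1
    have h2 := (h1.mono_left (nhdsWithin_le_nhds (s := Ioi 0))).eventually (gt_mem_nhds hε)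
    obtain ⟨η, h3, h4⟩ := (h2.and self_mem_nhdsWithin).exists
    exact ⟨η, h4, h3⟩
  obtain ⟨N, Q, r, hN, hQ, hτ, happ⟩ := hγ1.exists_step_approx hp0 hη
  refine ⟨fun x => γ (r (N x)), exists_hasRSIntegralOn_step hβc hR hN hQ (fun k => γ (r k)), ?_⟩
  intro M x y hx hy hxy
  have h1 := (hγ1.sub hp (by linarith) (hγ1.comp_monotone hτ)).two_mul_of_abs_le hp0
    (by linarith) hη.le happ
  have h2 := HK _ _ η (Real.sqrt_pos.2 (by positivity)) h1 happ M x y hx hy hxy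
  refine le_of_eq_of_le ?_ (h2.trans hsmall.le)
  congr 1
  simp only [rsSum, ← Finset.sum_sub_distrib, Function.comp_apply]
  exact Finset.sum_congr rfl fun i _ => by ring

/-! ### Uniform grids -/

/-- If `γ` vanishes outside `[a, a + L]`, its Riemann–Stieltjes integral over `(-R, R)` is the limit
of the sums over the cells of a uniform grid of `[a, a + L]`, for arbitrary interior tags. In
particular it does not depend on `R`. -/
theorem HasRSIntegralOn.eventually_grid {γ β : ℝ → ℝ} {a L R J : ℝ} (hL : 0 < L)
    (hsupp : Function.support γ ⊆ Icc a (a + L)) (hRa : -R < a) (hRL : a + L < R)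
    (h : HasRSIntegralOn γ β (Ioo (-R) R) J) {ε : ℝ} (hε : 0 < ε) :
    ∀ᶠ m : ℕ in atTop, ∀ y : ℕ → ℝ,
      (∀ i < m, y i ∈ Ioo (a + i * (L / m)) (a + (i + 1 : ℕ) * (L / m))) →
      |(∑ i ∈ Finset.range m, γ (y i) *
        (β (a + (i + 1 : ℕ) * (L / m)) - β (a + i * (L / m)))) - J| < ε := by
  obtain ⟨δ', hδ', H⟩ := h ε hε
  obtain ⟨m₀, hm₀⟩ := exists_nat_gt (L / δ')
  filter_upwards [eventually_ge_atTop m₀] with m hm y hy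
  have hm0 : (0:ℝ) < m :=
    (div_pos hL hδ').trans (hm₀.trans_le (by exact_mod_cast hm))
  set d := L / m with hd
  have hd0 : 0 < d := by positivity
  have hdδ : d < δ' := by
    have : L / δ' < m := hm₀.trans_le (by exact_mod_cast hm)
    rw [div_lt_iff₀ hδ'] at this
    rw [hd, div_lt_iff₀ hm0]
    linarith
  have hmd : m * d = L := by rw [hd]; field_simp
  have hlt : -R < R := by linarith
  -- the grid points in `(-R, R)` are `a - s d, …, a + (m + r) d`
  obtain ⟨s, hs1, hs2⟩ : ∃ s : ℕ, -R < a - s * d ∧ a - s * d ≤ -R + d := by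
    have h1 : 0 < (a + R) / d := div_pos (by linarith) hd0
    have h2 := Nat.ceil_pos.2 h1
    have h3 := Nat.ceil_lt_add_one h1.le
    have h4 := Nat.le_ceil ((a + R) / d)
    have e : ((⌈(a + R) / d⌉₊ - 1 : ℕ) : ℝ) = ⌈(a + R) / d⌉₊ - 1 := by
      rw [Nat.cast_sub h2]; simp
    rw [← sub_lt_iff_lt_add, lt_div_iff₀ hd0] at h3
    rw [div_le_iff₀ hd0] at h4
    exact ⟨_, by rw [e]; linarith, by rw [e]; linarith⟩
  obtain ⟨r, hr1, hr2⟩ : ∃ r : ℕ, a + L + r * d < R ∧ R - d ≤ a + L + r * d := by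
    have h1 : 0 < (R - (a + L)) / d := div_pos (by linarith) hd0
    have h2 := Nat.ceil_pos.2 h1
    have h3 := Nat.ceil_lt_add_one h1.le
    have h4 := Nat.le_ceil ((R - (a + L)) / d)
    have e : ((⌈(R - (a + L)) / d⌉₊ - 1 : ℕ) : ℝ) = ⌈(R - (a + L)) / d⌉₊ - 1 := by
      rw [Nat.cast_sub h2]; simp
    rw [← sub_lt_iff_lt_add, lt_div_iff₀ hd0] at h3
    rw [div_le_iff₀ hd0] at h4
    exact ⟨_, by rw [e]; linarith, by rw [e]; linarith⟩
  set X : ℕ → ℝ := fun i => a + ((i:ℝ) - s) * d with hX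
  set Y : ℕ → ℝ := fun i =>
    if s ≤ i ∧ i < s + m then y (i - s) else a + ((i:ℝ) - s + 1 / 2) * d with hY
  have hYX : ∀ i, X i < Y i ∧ Y i < X (i + 1) := by
    intro i
    simp only [hX, hY]
    split_ifs with hi
    · have h1 := hy (i - s) (by omega)
      have e : ((i - s : ℕ) : ℝ) = i - s := Nat.cast_sub hi.1
      rw [mem_Ioo, Nat.cast_add, e] at h1
      push_cast at h1 ⊢
      constructor
      · linarith [h1.1]
      · linarith [h1.2]
    · push_cast
      constructor <;> nlinarith
  have hXm : StrictMono X := strictMono_nat_of_lt_succ fun i => (hYX i).1.trans (hYX i).2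
  have hYm : StrictMono Y := strictMono_nat_of_lt_succ fun i => (hYX i).2.trans (hYX (i + 1)).1
  have hX0 : X 0 = a - s * d := by simp only [hX]; push_cast; ring
  have hXlast : X (s + m + r) = a + L + r * d := by
    simp only [hX]; push_cast; rw [← hmd]; ring
  have hXA : ∀ i ≤ s + m + r, X i ∈ Ioo (-R) R := fun i hi =>
    ⟨by linarith [hXm.monotone (Nat.zero_le i)], by linarith [hXm.monotone hi]⟩
  have key := H (s + m + r) (fun i => X i) (fun i => Y i)
    ⟨fun i j hij => hXm hij, fun i => hXA _ (by omega)⟩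
    ⟨fun i j hij => hYm hij, fun i => ⟨(hXA i (by omega)).1.trans (hYX i).1,
      (hYX i).2.trans (hXA (i + 1) (by omega)).2⟩⟩
    (fun i => ⟨(hYX i).1.le, (hYX i).2.le⟩) (by
      rw [partitionResolution, csInf_Ioo hlt, csSup_Ioo hlt]
      refine max_lt ?_ (max_lt ?_ ?_)
      · simp only [Fin.val_zero, hX0]
        linarith
      · refine lt_of_le_of_lt (Real.iSup_le (fun i => ?_) hd0.le) hdδ
        simp only [Fin.val_succ, Fin.val_castSucc, hX]
        push_cast
        linarith
      · simp only [Fin.val_last, hXlast]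
        linarith)
  have hsum : rsSum γ β (fun i : Fin (s + m + r + 1) => X i) (fun i : Fin (s + m + r) => Y i) =
      ∑ i ∈ Finset.range m, γ (y i) * (β (a + (i + 1 : ℕ) * d) - β (a + i * d)) := by
    have e : rsSum γ β (fun i : Fin (s + m + r + 1) => X i)
        (fun i : Fin (s + m + r) => Y i) =
        ∑ i ∈ Finset.range (s + m + r), γ (Y i) * (β (X (i + 1)) - β (X i)) := by
      rw [Finset.sum_range]
      rfl
    have hγ0 : ∀ z, z ∉ Icc a (a + L) → γ z = 0 := fun z hz =>
      Function.notMem_support.1 fun h => hz (hsupp h)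
    rw [e, Finset.sum_range_add, Finset.sum_range_add]
    rw [Finset.sum_eq_zero (s := Finset.range s), Finset.sum_eq_zero (s := Finset.range r),
      zero_add, add_zero]
    · refine Finset.sum_congr rfl fun i hi => ?_
      have hi' := Finset.mem_range.1 hi
      have e1 : Y (s + i) = y i := by
        simp only [hY]
        rw [if_pos ⟨by omega, by omega⟩]
        congr 1
        omega
      have e2 : X (s + i) = a + i * d := by simp only [hX]; push_cast; ring
      have e3 : X (s + i + 1) = a + (i + 1 : ℕ) * d := by simp only [hX]; push_cast; ring
      rw [e1, e2, e3]
    · intro i _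
      have hgt : a + L < Y (s + m + i) := by
        have h1 := (hYX (s + m + i)).1
        have h2 := hXm.monotone (show s + m ≤ s + m + i by omega)
        have h3 : X (s + m) = a + L := by simp only [hX]; push_cast; rw [← hmd]; ring
        linarith
      rw [hγ0 _ (fun hmem => absurd hmem.2 (not_le.2 hgt)), zero_mul]
    · intro i hi
      have hi' := Finset.mem_range.1 hi
      have hlt' : Y i < a := by
        have h1 := (hYX i).2
        have h2 := hXm.monotone (show i + 1 ≤ s by omega)
        have h3 : X s = a := by simp only [hX]; ring
        linarith
      rw [hγ0 _ (fun hmem => absurd hmem.1 (not_le.2 hlt')), zero_mul]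
  rw [hsum] at key
  exact key

/-- The tags can be chosen so that the values of `γ` are at most its averages over the cells. -/
theorem exists_tags_le_average {γ : ℝ → ℝ} (hγ : Integrable γ) (a : ℝ) {d : ℝ} (hd : 0 < d) :
    ∃ y : ℕ → ℝ, ∀ i : ℕ, y i ∈ Ioo (a + i * d) (a + (i + 1 : ℕ) * d) ∧
      γ (y i) * d ≤ ∫ x in (a + i * d)..(a + (i + 1 : ℕ) * d), γ x := by
  have key : ∀ i : ℕ, ∃ z, z ∈ Ioo (a + i * d) (a + (i + 1 : ℕ) * d) ∧
      γ z * d ≤ ∫ x in (a + i * d)..(a + (i + 1 : ℕ) * d), γ x := by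
    intro i
    have hv : a + (i + 1 : ℕ) * d - (a + i * d) = d := by push_cast; ring
    have hvol : volume (Ioo (a + i * d) (a + (i + 1 : ℕ) * d)) = ENNReal.ofReal d := by
      rw [Real.volume_Ioo, hv]
    obtain ⟨z, hz, hle⟩ := exists_le_setAverage (μ := volume) (f := γ)
      (s := Ioo (a + i * d) (a + (i + 1 : ℕ) * d)) (by rw [hvol]; simpa using hd)
      (by rw [hvol]; exact ENNReal.ofReal_ne_top) hγ.integrableOn
    refine ⟨z, hz, ?_⟩
    rw [setAverage_eq, measureReal_def, hvol, ENNReal.toReal_ofReal hd.le, smul_eq_mul] at hle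
    rw [intervalIntegral.integral_of_le (by linarith), integral_Ioc_eq_integral_Ioo]
    calc γ z * d ≤ (d⁻¹ * ∫ x in Ioo (a + i * d) (a + (i + 1 : ℕ) * d), γ x) * d := by gcongr
      _ = _ := by field_simp
  choose y hy using key
  exact ⟨y, hy⟩

theorem sum_tags_le_integral {γ : ℝ → ℝ} (hγ : Integrable γ) (hpos : ∀ x, 0 ≤ γ x) {a d : ℝ}
    (hd : 0 < d) {y : ℕ → ℝ}
    (hy : ∀ i : ℕ, γ (y i) * d ≤ ∫ x in (a + i * d)..(a + (i + 1 : ℕ) * d), γ x) (m : ℕ) :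
    ∑ i ∈ Finset.range m, γ (y i) * d ≤ ∫ x, γ x := by
  calc _ ≤ ∑ i ∈ Finset.range m, ∫ x in (a + i * d)..(a + (i + 1 : ℕ) * d), γ x :=
        Finset.sum_le_sum fun i _ => hy i
    _ = ∫ x in (a + (0 : ℕ) * d)..(a + m * d), γ x :=
        intervalIntegral.sum_integral_adjacent_intervals (a := fun i : ℕ => a + i * d)
          fun i _ => hγ.intervalIntegrable
    _ = ∫ x in Ioc (a + (0 : ℕ) * d) (a + m * d), γ x := by
        rw [intervalIntegral.integral_of_le]
        simp only [CharP.cast_eq_zero, zero_mul]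
        have : 0 ≤ m * d := by positivity
        linarith
    _ ≤ _ := setIntegral_le_integral hγ (ae_of_all _ hpos)

theorem starModulus_zero {ω : ℝ → ℝ} {p : ℝ} (hp : 1 ≤ p) (hω0 : ω 0 = 0) (c : ℝ) :
    starModulus ω p c 0 = 0 := by
  rw [starModulus, Real.zero_rpow (show 2 * p - 1 ≠ 0 by linarith), hω0]
  simp

/-- The bound of the theorem for the integral over a large interval. -/
theorem HasRSIntegralOn.le_starModulus {p : ℝ} (hp : 1 ≤ p) {ω : ℝ → ℝ}
    (hω : ConcaveOn ℝ (Ici 0) ω) (h0 : ∀ h ≥ 0, 0 ≤ ω h) (hω0 : ω 0 = 0) {C : ℝ}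
    (hC : ∀ h ∈ Ioo (0 : ℝ) 1, ω h ≤ C * h ^ (1 - 1 / (2 * p))) (hC0 : 0 ≤ C)
    {γ β : ℝ → ℝ} (hβ : ∀ x y, y ≤ x → β x - β y ≤ ω (x - y)) {a L R J V : ℝ} (hL : 0 < L)
    (hV : 0 ≤ V) (hγ : HasPVariationLE p V γ) (hγi : Integrable γ) (hpos : ∀ x, 0 ≤ γ x)
    (hsupp : Function.support γ ⊆ Icc a (a + L)) (hRa : -R < a) (hRL : a + L < R)
    (hJ : HasRSIntegralOn γ β (Ioo (-R) R) J) :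
    J ≤ V * L ^ (1 - 1 / p) * starModulus ω p ((256 * p + 2) * C)
      ((∫ x, |γ x|) / (V * L ^ (1 - 1 / p))) := by
  have hp0 : 0 < p := by linarith
  simp only [fun x => abs_of_nonneg (hpos x)]
  set S := ∫ x, γ x with hS
  have hγ0 : ∀ z, z ∉ Icc a (a + L) → γ z = 0 := fun z hz =>
    Function.notMem_support.1 fun h => hz (hsupp h)
  have hγV : ∀ x, γ x ≤ V := by
    intro x
    by_cases hx : x ∈ Icc a (a + L)
    · have h1 := hγ.abs_sub_le hp0 hV (show a - 1 ≤ x by linarith [hx.1])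
      rw [hγ0 (a - 1) (fun h => by linarith [h.1]), sub_zero] at h1
      exact (le_abs_self _).trans h1
    · rw [hγ0 x hx]
      exact hV
  refine le_of_forall_pos_le_add fun ε hε => ?_
  obtain ⟨m, hm, hm1⟩ :=
    ((hJ.eventually_grid hL hsupp hRa hRL hε).and (eventually_ge_atTop 1)).exists
  have hm0 : (0:ℝ) < m := by exact_mod_cast hm1
  have hd : 0 < L / m := by positivity
  obtain ⟨y, hy⟩ := exists_tags_le_average hγi a hd
  have hclose := (abs_lt.1 (hm y fun i _ => (hy i).1)).1
  have hsumS := sum_tags_le_integral hγi hpos hd (fun i => (hy i).2) m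
  rw [← hS] at hsumS
  refine le_trans (b := (∑ i ∈ Finset.range m, γ (y i) *
    (β (a + (i + 1 : ℕ) * (L / m)) - β (a + i * (L / m)))) + ε) (by linarith) ?_
  gcongr
  have hS0 : 0 ≤ S := integral_nonneg hpos
  rcases hS0.eq_or_lt with hS0 | hS0
  · -- the chosen tags are zeros of `γ`
    have h1 : ∑ i ∈ Finset.range m, γ (y i) * (L / m) = 0 :=
      le_antisymm (hS0 ▸ hsumS) (Finset.sum_nonneg fun i _ => mul_nonneg (hpos _) hd.le)
    rw [Finset.sum_eq_zero_iff_of_nonneg fun i _ => mul_nonneg (hpos _) hd.le] at h1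
    rw [Finset.sum_eq_zero, ← hS0, zero_div, starModulus_zero hp hω0, mul_zero]
    intro i hi
    rw [(mul_eq_zero.1 (h1 i hi)).resolve_right hd.ne', zero_mul]
  have hSV : S ≤ V * L := by
    have e : S = ∫ x in Icc a (a + L), γ x :=
      (setIntegral_eq_integral_of_forall_compl_eq_zero fun x hx => hγ0 x hx).symm
    have h1 := setIntegral_mono_on (μ := volume) hγi.integrableOn
      (integrableOn_const (C := V) (s := Icc a (a + L)) (by simp)) measurableSet_Icc
      (fun x _ => hγV x)
    rw [← e, setIntegral_const, measureReal_def, Real.volume_Icc, add_sub_cancel_left,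
      ENNReal.toReal_ofReal hL.le, smul_eq_mul] at h1
    linarith
  have hV0 : 0 < V := by
    rcases hV.eq_or_lt with h | h
    · rw [← h] at hSV; linarith
    · exact h
  have hD : 0 < V * L ^ (1 - 1 / p) := by positivity
  -- the values at the tags, with a point to the left and to the right of the support added
  set z : ℕ → ℝ := fun i => if i = 0 then a - 1 else if i ≤ m then y (i - 1) else a + L + 1
    with hz
  have hya : ∀ i : ℕ, a ≤ y i := fun i => by
    have : 0 ≤ (i:ℝ) * (L / m) := by positivity
    linarith [(hy i).1.1]
  have hyL : ∀ i < m, y i ≤ a + L := fun i hi => by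
    have h1 : ((i + 1 : ℕ) : ℝ) ≤ m := by exact_mod_cast hi
    have h2 : ((i + 1 : ℕ) : ℝ) * (L / m) ≤ m * (L / m) := by gcongr
    rw [mul_div_cancel₀ _ hm0.ne'] at h2
    linarith [(hy i).1.2]
  have hzm : Monotone z := by
    refine monotone_nat_of_le_succ fun i => ?_
    simp only [hz]
    rw [if_neg (Nat.succ_ne_zero i)]
    by_cases h1 : i = 0
    · rw [if_pos h1, if_pos (show i + 1 ≤ m by omega)]
      linarith [hya (i + 1 - 1)]
    · rw [if_neg h1]
      by_cases h2 : i + 1 ≤ m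
      · rw [if_pos (show i ≤ m by omega), if_pos h2]
        have h3 := (hy (i - 1)).1.2
        rw [show i - 1 + 1 = i by omega] at h3
        exact (h3.trans (hy i).1.1).le
      · rw [if_neg h2]
        split_ifs with h3
        · linarith [hyL (i - 1) (by omega)]
        · exact le_rfl
  have ez : ∀ i < m, z (i + 1) = y i := fun i hi => by
    simp only [hz]
    rw [if_neg (Nat.succ_ne_zero i), if_pos (show i + 1 ≤ m by omega), Nat.add_sub_cancel]
  set x : ℕ → ℝ := fun i => a + i * (L / m) with hx
  have hxm : Monotone x := fun i j hij => by
    have : (i:ℝ) ≤ j := by exact_mod_cast hij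
    simp only [hx]
    gcongr
  have hxL : x m - x 0 ≤ L := by
    simp only [hx, CharP.cast_eq_zero]
    rw [mul_div_cancel₀ _ hm0.ne']
    linarith
  have hcell : ∀ b : ℝ → ℝ, cellSum (γ ∘ z) (b ∘ x) m = ∑ i ∈ Finset.range m, γ (y i) *
      (b (a + (i + 1 : ℕ) * (L / m)) - b (a + i * (L / m))) := fun b =>
    Finset.sum_congr rfl fun i hi => by
      simp only [Function.comp_apply, ez i (Finset.mem_range.1 hi), hx]
  rw [← hcell]
  refine cellSum_le_starModulus hp hω h0 hC hC0 hβ hV0 hL (div_pos hS0 hD) ?_ hxm hxL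
    (hγ.comp_monotone hzm) (fun i => hpos _) ?_ ?_ ?_
  · have h1 : S / (V * L ^ (1 - 1 / p)) ≤ L ^ (1 / p) := by
      rw [div_le_iff₀ hD]
      calc S ≤ V * L := hSV
        _ = V * (L ^ (1 / p) * L ^ (1 - 1 / p)) := by
            rw [← Real.rpow_add hL]; simp
        _ = _ := by ring
    calc _ ≤ (L ^ (1 / p)) ^ p := Real.rpow_le_rpow (div_pos hS0 hD).le h1 hp0.le
      _ = L := by rw [← Real.rpow_mul hL.le, one_div_mul_cancel hp0.ne', Real.rpow_one]
  · simp only [Function.comp_apply, hz, if_true]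
    exact hγ0 _ fun h => by linarith [h.1]
  · simp only [Function.comp_apply, hz]
    rw [if_neg (Nat.succ_ne_zero m), if_neg (by omega)]
    exact hγ0 _ fun h => by linarith [h.2]
  · rw [mul_div_cancel₀ _ hD.ne']
    refine le_of_eq_of_le ?_ hsumS
    have := hcell id
    simp only [Function.id_comp, id_eq] at this
    rw [this]
    refine Finset.sum_congr rfl fun i _ => ?_
    push_cast
    ring

/-! ### The Osgood condition -/

theorem eq_zero_of_le_const_mul_rpow {ω : ℝ → ℝ} (hmono : MonotoneOn ω (Ici 0))
    (h0 : ∀ h ≥ 0, 0 ≤ ω h) {C α : ℝ} (hα : 0 < α)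
    (hC : ∀ h ∈ Ioo (0 : ℝ) 1, ω h ≤ C * h ^ α) : ω 0 = 0 := by
  refine le_antisymm ?_ (h0 0 le_rfl)
  have h1 : Tendsto (fun h : ℝ => C * h ^ α) (𝓝[>] 0) (𝓝 0) := by
    have h2 : Tendsto (fun h : ℝ => C * h ^ α) (𝓝 0) (𝓝 (C * 0 ^ α)) :=
      ((Real.continuousAt_rpow_const 0 α (Or.inr hα.le)).tendsto).const_mul C
    rw [Real.zero_rpow hα.ne', mul_zero] at h2
    exact h2.mono_left nhdsWithin_le_nhds
  refine ge_of_tendsto h1 ?_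
  filter_upwards [Ioo_mem_nhdsGT (show (0:ℝ) < 1 by norm_num)] with h hh
  exact (hmono (show (0:ℝ) ∈ Ici 0 by simp) hh.1.le hh.1.le).trans (hC h hh)

/-- The substitution `t = h ^ (2 p - 1)` turns `dh / starModulus ω p c h` into a constant times
`dt / (ω t + c t)`, and `ω t` dominates `t` near zero by concavity. -/
theorem IsOsgoodModulus.starModulus {p : ℝ} (hp : 1 ≤ p) {ω : ℝ → ℝ}
    (hω : ConcaveOn ℝ (Ici 0) ω) (hω0 : ω 0 = 0) {C : ℝ}
    (hC : ∀ h ∈ Ioo (0 : ℝ) 1, ω h ≤ C * h ^ (1 - 1 / (2 * p))) {c : ℝ} (hc : 0 ≤ c)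
    (hO : IsOsgoodModulus ω) : IsOsgoodModulus (starModulus ω p c) := by
  have hp0 : 0 < p := by linarith
  have hr : 0 < 2 * p - 1 := by linarith
  have hω1 := hO.pos 1 one_pos
  have hnonneg : ∀ h ≥ 0, 0 ≤ _root_.starModulus ω p c h := fun h hh =>
    add_nonneg (mul_nonneg (by positivity) (hO.nonneg _ (by positivity))) (by positivity)
  have hpos : ∀ h > 0, 0 < _root_.starModulus ω p c h := fun h hh =>
    add_pos_of_pos_of_nonneg (mul_pos (by positivity) (hO.pos _ (by positivity)))
      (by positivity)
  refine ⟨?_, hnonneg, hpos, ?_⟩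
  · intro h hh
    rcases (show (0:ℝ) ≤ h from hh).eq_or_lt with rfl | hh
    · have e : _root_.starModulus ω p c 0 = 0 := starModulus_zero hp hω0 c
      rw [ContinuousWithinAt, e]
      have h1 : Tendsto (fun h : ℝ => C * h ^ (1 / (2 * p)) + c * h) (𝓝[≥] 0) (𝓝 0) := by
        have h2 : Tendsto (fun h : ℝ => C * h ^ (1 / (2 * p)) + c * h) (𝓝 0)
            (𝓝 (C * 0 ^ (1 / (2 * p)) + c * 0)) :=
          (((Real.continuousAt_rpow_const 0 (1 / (2 * p))
            (Or.inr (by positivity))).tendsto).const_mul C).add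
            (tendsto_id.const_mul c)
        rw [Real.zero_rpow (by positivity), mul_zero, mul_zero, add_zero] at h2
        exact h2.mono_left nhdsWithin_le_nhds
      refine tendsto_of_tendsto_of_tendsto_of_le_of_le' tendsto_const_nhds h1 ?_ ?_
      · filter_upwards [self_mem_nhdsWithin] with h hh
        exact hnonneg h hh
      · filter_upwards [Ico_mem_nhdsGE (show (0:ℝ) < 1 by norm_num)] with h hh
        rcases hh.1.eq_or_lt with rfl | hpos'
        · rw [e, Real.zero_rpow (by positivity)]
          simp
        · unfold _root_.starModulus
          refine add_le_add ?_ le_rfl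
          have h3 := hC (h ^ (2 * p - 1)) ⟨by positivity, Real.rpow_lt_one hh.1 hh.2 hr⟩
          calc h ^ (2 - 2 * p) * ω (h ^ (2 * p - 1))
              ≤ h ^ (2 - 2 * p) * (C * (h ^ (2 * p - 1)) ^ (1 - 1 / (2 * p))) := by gcongr
            _ = C * (h ^ (2 - 2 * p) * h ^ ((2 * p - 1) * (1 - 1 / (2 * p)))) := by
                rw [← Real.rpow_mul hh.1]; ring
            _ = C * h ^ (1 / (2 * p)) := by
                rw [← Real.rpow_add hpos']
                congr 2
                field_simp
                ring
    · refine ContinuousAt.continuousWithinAt ?_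
      have h1 : ContinuousAt ω (h ^ (2 * p - 1)) :=
        hO.continuousOn.continuousAt (Ici_mem_nhds (by positivity))
      have h2 : ∀ q : ℝ, ContinuousAt (fun h : ℝ => h ^ q) h := fun q =>
        Real.continuousAt_rpow_const h q (Or.inl hh.ne')
      exact ((h2 _).mul (ContinuousAt.comp (f := fun h : ℝ => h ^ (2 * p - 1)) h1 (h2 _))).add
        (continuousAt_const.mul continuousAt_id)
  · intro ε hε
    set ε' := min ε 1 with hε'
    have hε'0 : 0 < ε' := lt_min hε one_pos
    set D := (2 * p - 1) * (1 + c / ω 1) with hD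
    have hD0 : 0 ≤ D := by positivity
    have himage : (fun h : ℝ => h ^ (2 * p - 1)) '' Ioo 0 ε' = Ioo 0 (ε' ^ (2 * p - 1)) := by
      ext t
      constructor
      · rintro ⟨h, hh, rfl⟩
        exact ⟨Real.rpow_pos_of_pos hh.1 _, Real.rpow_lt_rpow hh.1.le hh.2 hr⟩
      · rintro ⟨ht0, ht⟩
        refine ⟨t ^ (2 * p - 1)⁻¹, ⟨by positivity, ?_⟩, Real.rpow_inv_rpow ht0.le hr.ne'⟩
        rwa [Real.rpow_inv_lt_iff_of_pos ht0.le hε'0.le hr]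
    have hsub := lintegral_image_eq_lintegral_abs_deriv_mul (s := Ioo 0 ε')
      (f := fun h : ℝ => h ^ (2 * p - 1)) (f' := fun h => (2 * p - 1) * h ^ (2 * p - 1 - 1))
      measurableSet_Ioo
      (fun h hh => (Real.hasDerivAt_rpow_const (Or.inl hh.1.ne')).hasDerivWithinAt)
      (fun h hh h' hh' e => (Real.rpow_left_inj hh.1.le hh'.1.le hr.ne').1 e)
      (fun t => ENNReal.ofReal (1 / ω t))
    rw [himage, hO.lintegral_eq_top _ (by positivity)] at hsub
    have hle : ∀ h ∈ Ioo 0 ε', ENNReal.ofReal |(2 * p - 1) * h ^ (2 * p - 1 - 1)| *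
        ENNReal.ofReal (1 / ω (h ^ (2 * p - 1))) ≤
        ENNReal.ofReal D * ENNReal.ofReal (1 / _root_.starModulus ω p c h) := by
      intro h hh
      have hh0 := hh.1
      have ht1 : h ^ (2 * p - 1) ≤ 1 :=
        Real.rpow_le_one hh0.le (hh.2.le.trans (min_le_right _ _)) hr.le
      have ht0 : 0 < h ^ (2 * p - 1) := by positivity
      have hωt := hO.pos _ ht0
      have hst := hpos h hh0
      rw [← ENNReal.ofReal_mul (abs_nonneg _), ← ENNReal.ofReal_mul hD0]
      refine ENNReal.ofReal_le_ofReal ?_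
      rw [abs_of_nonneg (by positivity), mul_one_div, mul_one_div,
        div_le_div_iff₀ hωt hst]
      have h1 : h ^ (2 * p - 1 - 1) * _root_.starModulus ω p c h =
          ω (h ^ (2 * p - 1)) + c * h ^ (2 * p - 1) := by
        unfold _root_.starModulus
        have e1 : h ^ (2 * p - 1 - 1) * h ^ (2 - 2 * p) = 1 := by
          rw [← Real.rpow_add hh0]
          ring_nf
          exact Real.rpow_zero h
        have e2 : h ^ (2 * p - 1 - 1) * h = h ^ (2 * p - 1) := by
          rw [← Real.rpow_add_one hh0.ne']
          ring_nf
        calc _ = h ^ (2 * p - 1 - 1) * h ^ (2 - 2 * p) * ω (h ^ (2 * p - 1)) +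
              c * (h ^ (2 * p - 1 - 1) * h) := by ring
          _ = _ := by rw [e1, e2, one_mul]
      have h2 : h ^ (2 * p - 1) * ω 1 ≤ ω (h ^ (2 * p - 1)) := by
        have h3 := hω.apply_mul_le_mul_apply hO.nonneg (one_le_one_div ht0 ht1) ht0.le
        rw [one_div_mul_cancel ht0.ne'] at h3
        calc _ ≤ h ^ (2 * p - 1) * (1 / h ^ (2 * p - 1) * ω (h ^ (2 * p - 1))) := by gcongr
          _ = _ := by field_simp
      have h4 : c * h ^ (2 * p - 1) ≤ c / ω 1 * ω (h ^ (2 * p - 1)) := by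
        calc c * h ^ (2 * p - 1) = c / ω 1 * (h ^ (2 * p - 1) * ω 1) := by field_simp
          _ ≤ _ := by gcongr
      calc (2 * p - 1) * h ^ (2 * p - 1 - 1) * _root_.starModulus ω p c h
          = (2 * p - 1) * (ω (h ^ (2 * p - 1)) + c * h ^ (2 * p - 1)) := by
            rw [mul_assoc, h1]
        _ ≤ (2 * p - 1) * (ω (h ^ (2 * p - 1)) + c / ω 1 * ω (h ^ (2 * p - 1))) := by gcongr
        _ = _ := by rw [hD]; ring
    have h5 : ∞ ≤ ENNReal.ofReal D *
        ∫⁻ h in Ioo 0 ε', ENNReal.ofReal (1 / _root_.starModulus ω p c h) := by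
      rw [← lintegral_const_mul' _ _ ENNReal.ofReal_ne_top, hsub]
      exact setLIntegral_mono' measurableSet_Ioo hle
    have h6 : ∫⁻ h in Ioo 0 ε', ENNReal.ofReal (1 / _root_.starModulus ω p c h) = ∞ := by
      by_contra hne
      exact (ENNReal.mul_lt_top ENNReal.ofReal_lt_top (lt_top_iff_ne_top.2 hne)).not_ge h5
    rw [eq_top_iff, ← h6]
    exact lintegral_mono_set (Ioo_subset_Ioo_right (min_le_left _ _))

/-! ### Conclusion -/

theorem HasPVariationLE.integrable_of_support_subset {p V a L : ℝ} (hp : 0 < p) (hV : 0 ≤ V)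
    {γ : ℝ → ℝ} (hγ : HasPVariationLE p V γ) (hsupp : Function.support γ ⊆ Icc a (a + L)) :
    Integrable γ := by
  have hb : ∀ x, ‖γ x‖ ≤ V := by
    intro x
    by_cases hx : γ x = 0
    · simpa [hx] using hV
    · have h1 := hγ.abs_sub_le hp hV (show a - 1 ≤ x by linarith [(hsupp hx).1])
      have h2 : γ (a - 1) = 0 := by
        by_contra h
        linarith [(hsupp h).1]
      rwa [h2, sub_zero] at h1
  rw [← integrableOn_iff_integrable_of_support_subset hsupp]
  exact Measure.integrableOn_of_bounded (by simp) (hγ.measurable hp).aestronglyMeasurable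
    (ae_of_all _ hb)

/-- For a compactly supported function, the integral over `ℝ` exists as soon as those over bounded
intervals do. -/
theorem exists_hasRSIntegral_of_support_subset {γ β : ℝ → ℝ} {a L : ℝ} (hL : 0 < L)
    (hsupp : Function.support γ ⊆ Icc a (a + L))
    (h : ∀ R > 0, ∃ I, HasRSIntegralOn γ β (Ioo (-R) R) I) : ∃ I, HasRSIntegral γ β I := by
  choose! J hJ using h
  set R₀ := |a| + L + 1 with hR₀
  have hbig : ∀ R ≥ R₀, -R < a ∧ a + L < R := fun R hR =>
    ⟨by linarith [neg_abs_le a], by linarith [le_abs_self a]⟩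
  have hR₀pos : 0 < R₀ := by positivity
  have hconst : ∀ R ≥ R₀, J R = J R₀ := by
    intro R hR
    refine eq_of_forall_dist_le fun ε hε => ?_
    have h1 := (hJ R (hR₀pos.trans_le hR)).eventually_grid hL hsupp (hbig R hR).1
      (hbig R hR).2 (half_pos hε)
    have h2 := (hJ R₀ hR₀pos).eventually_grid hL hsupp (hbig R₀ le_rfl).1
      (hbig R₀ le_rfl).2 (half_pos hε)
    obtain ⟨m, ⟨h3, h4⟩, hm⟩ := ((h1.and h2).and (eventually_ge_atTop 1)).exists
    have hm0 : (0:ℝ) < m := by exact_mod_cast hm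
    have hd : 0 < L / m := by positivity
    have hmid : ∀ i < m, (fun i : ℕ => a + (i + 1 / 2 : ℝ) * (L / m)) i ∈
        Ioo (a + i * (L / m)) (a + (i + 1 : ℕ) * (L / m)) := by
      intro i _
      push_cast
      constructor <;> nlinarith
    have h5 := abs_lt.1 (h3 _ hmid)
    have h6 := abs_lt.1 (h4 _ hmid)
    rw [Real.dist_eq, abs_le]
    constructor <;> linarith [h5.1, h5.2, h6.1, h6.2]
  refine ⟨J R₀, J, hJ, tendsto_const_nhds.congr' ?_⟩
  filter_upwards [eventually_ge_atTop R₀] with R hR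
  exact (hconst R hR).symm

theorem mainTheorem3 (p : ℝ) (hp : 1 ≤ p) :
    ∃ K : ℝ, 0 ≤ K ∧
      ∀ ω : ℝ → ℝ, ConcaveOn ℝ (Ici 0) ω → (∀ h ≥ 0, 0 ≤ ω h) → IsHolderAllOrdersLTOne ω →
      ∀ C : ℝ, (∀ h ∈ Ioo (0 : ℝ) 1, ω h ≤ C * h ^ (1 - 1 / (2 * p))) →
        (∀ (L : ℝ) (γ β : ℝ → ℝ), 0 < L →
          ePVariationOn p γ univ ≠ ∞ → (∀ x, 0 ≤ γ x) →
          (∃ a : ℝ, Function.support γ ⊆ Icc a (a + L)) →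
          Continuous β → HasOneSidedModulus β ω →
          Integrable γ ∧ (∃ I : ℝ, HasRSIntegral γ β I) ∧
          ∀ I : ℝ, HasRSIntegral γ β I →
            I ≤ pVariationOn p γ univ * L ^ (1 - 1 / p) *
              starModulus ω p (K * C)
                ((∫ x, |γ x|) / (pVariationOn p γ univ * L ^ (1 - 1 / p)))) ∧
        (IsOsgoodModulus ω → IsOsgoodModulus (starModulus ω p (K * C))) := by
  have hp0 : 0 < p := by linarith
  refine ⟨256 * p + 2, by positivity, fun ω hω h0 hH C hC => ?_⟩
  have hα : 0 < 1 - 1 / (2 * p) := by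
    rw [sub_pos, div_lt_one (by positivity)]
    linarith
  have hω0 : ω 0 = 0 :=
    eq_zero_of_le_const_mul_rpow (hω.monotoneOn_of_nonneg h0) h0 hα hC
  have hC0 : 0 ≤ C := by
    have h1 := (h0 (1 / 2) (by norm_num)).trans (hC (1 / 2) (by constructor <;> norm_num))
    exact nonneg_of_mul_nonneg_left h1 (by positivity)
  refine ⟨?_, fun hO => hO.starModulus hp hω hω0 hC (by positivity)⟩
  rintro L γ β hL hγ hpos ⟨a, hsupp⟩ hβc hβ
  have hβ' : ∀ x y, y ≤ x → β x - β y ≤ ω (x - y) := by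
    intro x y hxy
    rcases hxy.eq_or_lt with rfl | hlt
    · simp [hω0]
    · exact hβ x y hlt
  have hV : 0 ≤ pVariationOn p γ univ := ENNReal.toReal_nonneg
  have hγ' := hasPVariationLE_pVariationOn hp hγ
  have hγi := hγ'.integrable_of_support_subset hp0 hV hsupp
  refine ⟨hγi, exists_hasRSIntegral_of_support_subset hL hsupp fun R hR =>
    exists_hasRSIntegralOn hp hω h0 hH hβc hβ' hV hγ' hR, ?_⟩
  rintro I ⟨J, hJ, hlim⟩
  refine le_of_tendsto hlim ?_
  filter_upwards [eventually_ge_atTop (|a| + L + 1)] with R hR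
  have h1 := abs_nonneg a
  exact (hJ R (by linarith)).le_starModulus hp hω h0 hω0 hC hC0 hβ' hL hV hγ' hγi hpos hsupp
    (by linarith [neg_abs_le a]) (by linarith [le_abs_self a])
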